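/- Let $q$ be a prime power and let $r,i\ge 1$ be integers such that $i$ divides $r$. Let $(F_k/\mathbb{F}_q)_{k\ge 1}$ be a sequence of algebraic function fields of one variable with full constant field $\mathbb{F}_q$, whose genera $g_k=g(F_k/\mathbb{F}_q)$ form an increasing (that is, non-decreasing) sequence tending to infinity. Write $B_m(F_k/\mathbb{F}_q)$ for the number of places of degree $m$ of $F_k/\mathbb{F}_q$. Such a sequence is called asymptotically exact of type $(\beta_1,\beta_2,\dots)$ if for every $m\ge 1$ the limit $\lim_{k\to\infty} B_m(F_k/\mathbb{F}_q)/g_k$ exists and equals $\beta_m$; the same definition applies over any finite field. Suppose that $(F_k/\mathbb{F}_q)_{k\ge 1}$ is asymptotically exact of type given by $\beta_r=\frac{1}{r}\left(q^{r/2}-1\right)$ and $\beta_m=0$ for all $m\ge 1$, $m\ne r$. Then the sequence $(F_k\mathbb{F}_{q^i}/\mathbb{F}_{q^i})_{k\ge 1}$ of constant field extensions is a sequence of algebraic function fields with full constant field $\mathbb{F}_{q^i}$, of non-decreasing genus tending to infinity, and it is asymptotically exact of type given by $\beta_{r/i}=\frac{i}{r}\left(q^{r/2}-1\right)$ and $\beta_m=0$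 for all $m\ge 1$, $m\neq r/i$. -/

import Mathlib

open Filter Topology

noncomputable section

namespace AlgFunctionField

/-- `F` is an algebraic function field of one variable over `k`, with full constant field `k`:
some `x : F` is transcendental over `k`, `F` is a finite extension of `k(x)`, and every element
of `F` that is algebraic over `k` lies in `k`. -/
structure IsFunctionField (k F : Type*) [Field k] [Field F] [Algebra k F] : Prop where
  exists_finite : ∃ x : F, Transcendental k x ∧
    FiniteDimensional (IntermediateField.adjoin k ({x} : Set F)) F
  algebraicClosure_eq_bot : algebraicClosure k F = ⊥

/-- A place of `F / k`, given by its valuation ring `k ⊆ O ⊊ F`. -/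
structure Place (k F : Type*) [Field k] [Field F] [Algebra k F] extends ValuationSubring F where
  algebraMap_mem : ∀ a : k, algebraMap k F a ∈ toValuationSubring
  ne_top : toValuationSubring ≠ ⊤

section

variable {k F : Type*} [Field k] [Field F] [Algebra k F]

instance Place.algebra (P : Place k F) : Algebra k P.toValuationSubring :=
  ((algebraMap k F).codRestrict P.toValuationSubring P.algebraMap_mem).toAlgebra

/-- The degree of a place: the degree of its residue field over `k`. -/
def Place.degree (P : Place k F) : ℕ :=
  Module.finrank k (IsLocalRing.ResidueField P.toValuationSubring)

end

/-- Divisors of `F / k`: finite formal `ℤ`-linear combinations of places. -/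
abbrev Divisor (k F : Type*) [Field k] [Field F] [Algebra k F] : Type _ :=
  Place k F →₀ ℤ

section

variable {k F : Type*} [Field k] [Field F] [Algebra k F]

/-- The degree of a divisor. -/
def Divisor.degree (A : Divisor k F) : ℤ :=
  A.sum fun P n => n * (P.degree : ℤ)

/-- The Riemann-Roch space `L(A)` of all `x` with `v_P(x) ≥ -A(P)` at every place `P`.

The valuation is written multiplicatively, so the condition is `|x|_P ≤ |t|_P ^ (-A(P))`, where `t`
is a uniformizer at `P`. In a function field each valuation ring of a place is a discrete
valuation ring, its uniformizers are its irreducible elements, and `|t|_P` does not depend on the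
choice of `t`. -/
def riemannRochSpace (A : Divisor k F) : Submodule k F where
  carrier := {x | ∀ (P : Place k F) (t : P.toValuationSubring), Irreducible t →
    P.toValuationSubring.valuation x ≤ P.toValuationSubring.valuation (t : F) ^ (-A P)}
  add_mem' := fun hx hy P t ht =>
    (P.toValuationSubring.valuation.map_add_le (hx P t ht) (hy P t ht))
  zero_mem' := fun P t _ => by simp
  smul_mem' := fun c x hx P t ht => by
    rw [Algebra.smul_def, map_mul]
    exact (mul_le_of_le_one_left' ((P.toValuationSubring.valuation_le_one_iff _).2
      (P.algebraMap_mem c))).trans (hx P t ht)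

end

/-- The genus `g = max_A (deg A - dim_k L(A) + 1)`, over all divisors `A` of `F / k`. -/
def genus (k F : Type*) [Field k] [Field F] [Algebra k F] : ℤ :=
  ⨆ A : Divisor k F, (A.degree - (Module.finrank k (riemannRochSpace A) : ℤ) + 1)

/-- `B_m(F / k)`: the number of places of degree `m`. -/
def numPlaces (k F : Type*) [Field k] [Field F] [Algebra k F] (m : ℕ) : ℕ :=
  {P : Place k F | P.degree = m}.ncard

/-- The sequence `(F n / k)` of algebraic function fields, of increasing genus growing to infinity,
is asymptotically exact: `B_m(F n / k) / g(F n / k)` converges for every `m ≥ 1`. -/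
structure IsAsymptoticallyExact (k : Type*) [Field k] (F : ℕ → Type*) [∀ n, Field (F n)]
    [∀ n, Algebra k (F n)] : Prop where
  isFunctionField : ∀ n, IsFunctionField k (F n)
  monotone_genus : Monotone fun n => genus k (F n)
  tendsto_genus : Tendsto (fun n => genus k (F n)) atTop atTop
  exists_tendsto : ∀ m : ℕ, 1 ≤ m → ∃ b : ℝ,
    Tendsto (fun n => (numPlaces k (F n) m : ℝ) / (genus k (F n) : ℝ)) atTop (𝓝 b)

/-- The sequence `(F n / k)` is asymptotically exact of type `(β 1, β 2, …)`. The value `β 0` plays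
no role. -/
structure IsAsymptoticallyExactOfType (k : Type*) [Field k] (F : ℕ → Type*) [∀ n, Field (F n)]
    [∀ n, Algebra k (F n)] (β : ℕ → ℝ) : Prop where
  isAsymptoticallyExact : IsAsymptoticallyExact k F
  tendsto : ∀ m : ℕ, 1 ≤ m →
    Tendsto (fun n => (numPlaces k (F n) m : ℝ) / (genus k (F n) : ℝ)) atTop (𝓝 (β m))

/-- `E / k'` is the constant field extension of `F / k` by `k'`: the field `E` contains `F` and
`k'` compatibly over `k`, and is their compositum. -/
def IsConstantFieldExtension (k k' F E : Type*) [Field k] [Field k'] [Field F] [Field E]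
    [Algebra k k'] [Algebra k F] [Algebra k E] [Algebra k' E] [Algebra F E]
    [IsScalarTower k k' E] [IsScalarTower k F E] : Prop :=
  IntermediateField.adjoin F (Set.range (algebraMap k' E)) = ⊤

end AlgFunctionField

end

/-!
The constant field extension `E = F k'` is governed, above a place `P` of `F`, by the ring
`k' ⊗ O_P`, which embeds into `E`. Its reduction `k' ⊗ κ(P)` modulo a uniformizer `t` of `P` is a
compositum of finite fields, so that `y ^ (q ^ N) ≡ y` modulo `t` for a suitable `N`
(`Place.exists_pow_sub_self_eq`). This congruence replaces the theory of étale algebras: powers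
`y ^ (q ^ N - 1)` are idempotents modulo `t`, and they show that `O_Q` is a localization of
`k' ⊗ O_P` for every place `Q` above `P` (`Place.exists_unit_mul_eq_tensorMap`), that `t` remains a
uniformizer at `Q` (`Place.exists_irreducible_eq_algebraMap`), and that `k' ⊗ O_P` is the
intersection of all these `O_Q` (`Place.exists_eq_tensorMap`).

*Places.* For a finite extension `L` of `k'`, an `L`-valued point of a function field is a place
together with an embedding of its residue field into `L`. Since `O_Q` is a localization of
`k' ⊗ O_P`, the `L`-valued points of `E / k'` and of `F / k` correspond to each other
(`bijective_restrictPoint`). Counting them for `[L : k'] = m` gives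
`∑_{d ∣ m} d B_d(E / k') = ∑_{d ∣ i m} d B_d(F / k)` (`sum_divisors_numPlaces`).

*Genus.* The same count over a single place gives `∑_{Q ∣ P} deg Q = deg P`, so conorms of divisors
preserve the degree. As `k' ⊗ O_P` is an intersection of valuation rings, the coordinates with
respect to a basis of `k' / k` identify `L(Con A)` with `k' ⊗ L(A)`. Every divisor of `E` lies below
a conorm, and `deg A - dim L(A)` is monotone in `A`, so the genera of `E` and `F` agree
(`genus_eq`).

*Limits.* Dividing the relation between the numbers of places by the common genus, its right-hand
side tends to `∑_{d ∣ i m} d β_d`, which is `q ^ (r / 2) - 1` if `r / i` divides `m`, and `0`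
otherwise. Inverting the sum over divisors gives the limits for `E`
(`tendsto_of_tendsto_sum_divisors`).
-/

namespace AlgFunctionField

open Polynomial IntermediateField TensorProduct

/-! ### Relations over `k(t)` -/

section General

variable {k F : Type*} [Field k] [Field F] [Algebra k F]

instance Place.isScalarTower (P : Place k F) : IsScalarTower k P.toValuationSubring F :=
  IsScalarTower.of_algebraMap_eq fun _ => rfl

theorem Place.ext {P Q : Place k F} (h : P.toValuationSubring = Q.toValuationSubring) : P = Q := by
  cases P; cases Q; congr

theorem Place.mem_of_isIntegral (P : Place k F) {x : F} (hx : IsIntegral k x) :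
    x ∈ P.toValuationSubring := by
  have h : IsIntegral P.toValuationSubring x := hx.tower_top
  obtain ⟨y, hy⟩ := IsIntegrallyClosed.isIntegral_iff.1 h
  rw [← hy]
  exact y.2

/-- An element of the maximal ideal that is algebraic over `k` is zero, as its inverse would be
integral over `k`, hence in the valuation ring. -/
theorem Place.transcendental_of_mem_nonunits (P : Place k F) {t : F} (ht : t ≠ 0)
    (h : t ∈ P.toValuationSubring.nonunits) : Transcendental k t := by
  intro hta
  rcases P.toValuationSubring.mem_nonunits_iff_or.1 h with h | h
  · exact ht h
  · exact h (P.mem_of_isIntegral hta.isIntegral.inv)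

/-- `F` is finite over `k(t)` for every transcendental `t`, and not only for the one in the definition
of a function field: the transcendence degree is one, so `t` is a transcendence basis. -/
theorem IsFunctionField.finiteDimensional (hF : IsFunctionField k F) {t : F}
    (ht : Transcendental k t) : FiniteDimensional k⟮t⟯ F := by
  obtain ⟨x, hx, hfin⟩ := hF.exists_finite
  have hess : Algebra.EssFiniteType k F := by
    have : Algebra.EssFiniteType k k⟮x⟯ := by
      rw [IntermediateField.essFiniteType_iff]
      exact IntermediateField.fg_adjoin_finset {x} |> fun h => by simpa using h
    exact Algebra.EssFiniteType.comp k k⟮x⟯ F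
  have hbx : IsTranscendenceBasis k (fun _ : Unit => x) := by
    rw [isTranscendenceBasis_iff_algebraicIndependent_isAlgebraic]
    refine ⟨algebraicIndependent_unique_type_iff.2 hx, ⟨fun y => ?_⟩⟩
    rw [Set.range_const, ← IntermediateField.isAlgebraic_adjoin_iff]
    exact Algebra.IsAlgebraic.isAlgebraic y
  have hbt : IsTranscendenceBasis k (fun _ : Unit => t) := by
    apply AlgebraicIndependent.isTranscendenceBasis_of_lift_trdeg_le_of_finite
    · rw [algebraicIndependent_unique_type_iff]
      exact ht
    · rw [← hbx.lift_cardinalMk_eq_trdeg]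
  have halg := hbt.isAlgebraic_field
  rw [Set.range_const] at halg
  have : Algebra.EssFiniteType k⟮t⟯ F := Algebra.EssFiniteType.of_comp k _ F
  exact Algebra.finite_of_essFiniteType_of_isAlgebraic

/-- `F` has bounded dimension over `k(t)`, in denominator-free form: among more than `[F : k(t)]`
elements there is a relation with coefficients in `k[t]`, not all of which vanish at `t = 0`. -/
theorem IsFunctionField.exists_relation (hF : IsFunctionField k F) {t : F}
    (ht : Transcendental k t) : ∃ n : ℕ, ∀ (ι : Type*) [Fintype ι] (u : ι → F), n < Fintype.card ι →
      ∃ a : ι → k[X], ∑ j, aeval t (a j) * u j = 0 ∧ ∃ j, (a j).coeff 0 ≠ 0 := by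
  have := hF.finiteDimensional ht
  have ht0 : t ≠ 0 := fun h => ht (h ▸ isAlgebraic_zero)
  refine ⟨Module.finrank k⟮t⟯ F, fun ι _ u hn => ?_⟩
  have hdep : ¬ LinearIndependent k⟮t⟯ u := fun h => hn.not_ge h.fintype_card_le_finrank
  obtain ⟨c, hc, j₀, hj₀⟩ := Fintype.not_linearIndependent_iff.1 hdep
  have h1 : ∃ a : ι → k[X], ∑ j, aeval t (a j) * u j = 0 ∧ ∃ j, a j ≠ 0 := by
    classical
    have : ∀ j, ∃ p q : k[X], aeval t q ≠ 0 ∧ (c j : F) = aeval t p / aeval t q := by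
      intro j
      obtain ⟨p, q, h⟩ := (mem_adjoin_simple_iff k (c j : F)).1 (c j).2
      by_cases hq : aeval t q = 0
      · exact ⟨0, 1, by simp, by simpa [hq] using h⟩
      · exact ⟨p, q, hq, h⟩
    choose p q hq hpq using this
    refine ⟨fun j => p j * ∏ l ∈ Finset.univ.erase j, q l, ?_, j₀, ?_⟩
    · have : ∀ j, aeval t (p j * ∏ l ∈ Finset.univ.erase j, q l) * u j =
          aeval t (∏ l, q l) * (c j • u j) := by
        intro j
        rw [← Finset.mul_prod_erase Finset.univ q (Finset.mem_univ j), Algebra.smul_def,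
          IntermediateField.algebraMap_apply, hpq j, map_mul, map_mul]
        field_simp [hq j]
      rw [Finset.sum_congr rfl fun j _ => this j, ← Finset.mul_sum, hc, mul_zero]
    · refine mul_ne_zero ?_ (Finset.prod_ne_zero_iff.2 fun l _ h => hq l (by simp [h]))
      rintro h
      apply hj₀
      have := hpq j₀
      rw [h, map_zero, zero_div] at this
      exact_mod_cast this
  obtain ⟨a, ha, j, hj⟩ := h1
  -- divide by a power of `t`, by induction on the degree of a nonzero coefficient
  generalize hd : (a j).natDegree = d
  induction d using Nat.strong_induction_on generalizing a with
  | _ d ih =>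
    by_cases h : ∃ j, (a j).coeff 0 ≠ 0
    · exact ⟨a, ha, h⟩
    push Not at h
    have hdiv : ∀ j, a j = X * (a j).divX := fun j => by
      conv_lhs => rw [← divX_mul_X_add (a j), h j, map_zero, add_zero, mul_comm]
    refine ih _ ?_ (fun j => (a j).divX) ?_ ?_ rfl
    · rw [natDegree_divX_eq_natDegree_tsub_one, hd]
      have : 0 < d := by
        rw [← hd]
        by_contra h0
        apply hj
        rw [eq_C_of_natDegree_eq_zero (by omega : (a j).natDegree = 0), h j, map_zero]
      omega
    · have : t * ∑ j, aeval t (a j).divX * u j = 0 := by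
        rw [Finset.mul_sum, ← ha]
        refine Finset.sum_congr rfl fun j _ => ?_
        conv_rhs => rw [hdiv j, map_mul, aeval_X]
        ring
      exact (mul_eq_zero.1 this).resolve_left ht0
    · intro h0
      apply hj
      rw [hdiv j, h0, mul_zero]

end General

/-! ### Valuation rings, residue fields and finiteness of places -/

section General

variable {k F : Type*} [Field k] [Field F] [Algebra k F]

theorem Place.exists_mem_nonunits_ne_zero (P : Place k F) :
    ∃ t ∈ P.toValuationSubring.nonunits, t ≠ 0 := by
  by_contra! h
  refine P.ne_top (top_le_iff.1 fun x _ => ?_)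
  rcases eq_or_ne x 0 with rfl | hx
  · exact P.toValuationSubring.zero_mem
  by_contra hx'
  exact inv_ne_zero hx (h _ (P.toValuationSubring.inv_mem_nonunits_iff.2 (Or.inr hx')))

/-- `O_P / (t)` has dimension at most `[F : k(t)]`, since a relation over `k[t]` can be reduced modulo
`t`. -/
theorem Place.finiteDimensional_quotient (hF : IsFunctionField k F) (P : Place k F)
    {t : P.toValuationSubring} (ht : t ≠ 0) (htm : (t : F) ∈ P.toValuationSubring.nonunits) :
    FiniteDimensional k (P.toValuationSubring ⧸ Ideal.span {t}) := by
  have ht0 : (t : F) ≠ 0 := fun h => ht (Subtype.ext h)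
  obtain ⟨n, hn⟩ := hF.exists_relation (P.transcendental_of_mem_nonunits ht0 htm)
  refine Module.rank_lt_aleph0_iff.1 ?_
  refine lt_of_le_of_lt (rank_le (n := n) fun s hs => ?_) (Cardinal.natCast_lt_aleph0)
  by_contra! hlt
  choose u hu using fun x : s => Ideal.Quotient.mk_surjective x.1
  obtain ⟨a, ha, j, hj⟩ := hn s (fun x => (u x : F)) (by simpa using hlt)
  have key : ∑ x : s, (a x).coeff 0 • (x : P.toValuationSubring ⧸ Ideal.span {t}) = 0 := by
    have h1 : ∑ x : s, aeval t (a x) * u x = 0 := by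
      apply Subtype.ext
      have hc : ∀ p : k[X], ((aeval t p : P.toValuationSubring) : F) = aeval (t : F) p :=
        fun p => (aeval_algebraMap_apply F t p).symm
      simpa [hc] using ha
    have h2 := congrArg (Ideal.Quotient.mkₐ k (Ideal.span {t})) h1
    rw [map_zero, map_sum] at h2
    rw [← h2]
    refine Finset.sum_congr rfl fun x _ => ?_
    have ht' : Ideal.Quotient.mkₐ k (Ideal.span {t}) t = 0 :=
      Ideal.Quotient.eq_zero_iff_mem.2 (Ideal.mem_span_singleton_self t)
    rw [map_mul, ← aeval_algHom_apply, ht', ← coeff_zero_eq_aeval_zero', Algebra.smul_def]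
    congr 1
    exact (hu x).symm
  exact hj (Fintype.linearIndependent_iff.1 hs _ key j)

/-- The valuation ring of a place is discrete. It is Noetherian, as each of its nonzero ideals contains
some nonzero `t` in the maximal ideal, and `O_P / (t)` is finite-dimensional over `k`. -/
theorem Place.isDiscreteValuationRing (hF : IsFunctionField k F) (P : Place k F) :
    IsDiscreteValuationRing P.toValuationSubring := by
  obtain ⟨s, hs, hs0⟩ := P.exists_mem_nonunits_ne_zero
  set s' : P.toValuationSubring := ⟨s, P.toValuationSubring.nonunits_subset hs⟩ with hs'
  have hs'0 : s' ≠ 0 := fun h => hs0 (congrArg Subtype.val h)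
  have hnoeth : IsNoetherianRing P.toValuationSubring := by
    rw [isNoetherianRing_iff_ideal_fg]
    intro I
    rcases eq_or_ne I ⊥ with rfl | hI
    · exact Submodule.fg_bot
    obtain ⟨x, hx, hx0⟩ := Submodule.exists_mem_ne_zero_of_ne_bot hI
    have hxs : x * s' ∈ I := I.mul_mem_right _ hx
    have hfin : FiniteDimensional k (P.toValuationSubring ⧸ Ideal.span {x * s'}) := by
      refine P.finiteDimensional_quotient hF (mul_ne_zero hx0 hs'0) ?_
      refine P.toValuationSubring.coe_mem_nonunits_iff.2 (Ideal.mul_mem_left _ _ ?_)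
      exact P.toValuationSubring.coe_mem_nonunits_iff.1 hs
    have hn : IsNoetherian P.toValuationSubring (P.toValuationSubring ⧸ Ideal.span {x * s'}) :=
      isNoetherian_of_tower k inferInstance
    refine Submodule.fg_of_fg_map_of_fg_inf_ker (Submodule.mkQ (Ideal.span {x * s'}))
      (hn.noetherian _) ?_
    rw [Submodule.ker_mkQ, inf_eq_right.2 ((Ideal.span_singleton_le_iff_mem I).2 hxs)]
    exact ⟨{x * s'}, by simp [Ideal.span]⟩
  have hpir : IsPrincipalIdealRing P.toValuationSubring :=
    ((IsBezout.TFAE (R := P.toValuationSubring)).out 0 1).1 hnoeth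
  refine { not_a_field' := fun h => hs'0 ?_ }
  have := P.toValuationSubring.coe_mem_nonunits_iff (a := s').1 hs
  rwa [h] at this

theorem Place.finiteDimensional_residueField (hF : IsFunctionField k F) (P : Place k F) :
    FiniteDimensional k (IsLocalRing.ResidueField P.toValuationSubring) := by
  obtain ⟨s, hs, hs0⟩ := P.exists_mem_nonunits_ne_zero
  set s' : P.toValuationSubring := ⟨s, P.toValuationSubring.nonunits_subset hs⟩ with hs'
  have hs'0 : s' ≠ 0 := fun h => hs0 (congrArg Subtype.val h)
  have := P.finiteDimensional_quotient hF hs'0 hs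
  have hle : Ideal.span {s'} ≤ IsLocalRing.maximalIdeal P.toValuationSubring :=
    (Ideal.span_singleton_le_iff_mem _).2 (P.toValuationSubring.coe_mem_nonunits_iff.1 hs)
  refine Module.Finite.of_surjective (Ideal.Quotient.liftₐ (Ideal.span {s'})
    (IsScalarTower.toAlgHom k P.toValuationSubring
      (IsLocalRing.ResidueField P.toValuationSubring))
    fun a ha => (IsLocalRing.residue_eq_zero_iff a).2 (hle ha)).toLinearMap ?_
  intro y
  obtain ⟨a, rfl⟩ := IsLocalRing.residue_surjective y
  exact ⟨Ideal.Quotient.mk _ a, rfl⟩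

theorem Place.degree_pos (hF : IsFunctionField k F) (P : Place k F) : 0 < P.degree := by
  have := P.finiteDimensional_residueField hF
  exact Module.finrank_pos

theorem Place.eq_of_le (hF : IsFunctionField k F) (P : Place k F) {V : ValuationSubring F}
    (h : P.toValuationSubring ≤ V) (hV : V ≠ ⊤) : P.toValuationSubring = V := by
  have := P.isDiscreteValuationRing hF
  exact P.toValuationSubring.eq_of_le_of_ne_top h hV

section Finite

variable [Finite k]

theorem Place.residue_pow_eq (hF : IsFunctionField k F) (P : Place k F) {N : ℕ} (hN : P.degree ∣ N)
    (x : IsLocalRing.ResidueField P.toValuationSubring) : x ^ Nat.card k ^ N = x := by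
  have := P.finiteDimensional_residueField hF
  have : Finite (IsLocalRing.ResidueField P.toValuationSubring) := Module.finite_of_finite k
  have := Fintype.ofFinite (IsLocalRing.ResidueField P.toValuationSubring)
  obtain ⟨m, rfl⟩ := hN
  rw [pow_mul, Place.degree, ← Module.natCard_eq_pow_finrank, ← Fintype.card_eq_nat_card]
  exact FiniteField.pow_card_pow m x

theorem Place.pow_sub_self_mem_nonunits (hF : IsFunctionField k F) (P : Place k F) {N : ℕ}
    (hN : P.degree ∣ N) {x : F} (hx : x ∈ P.toValuationSubring) :
    x ^ Nat.card k ^ N - x ∈ P.toValuationSubring.nonunits := by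
  have h : (⟨x, hx⟩ : P.toValuationSubring) ^ Nat.card k ^ N - ⟨x, hx⟩ ∈
      IsLocalRing.maximalIdeal P.toValuationSubring := by
    rw [← IsLocalRing.residue_eq_zero_iff, map_sub, map_pow, P.residue_pow_eq hF hN, sub_self]
  exact P.toValuationSubring.coe_mem_nonunits_iff.2 h

/-- Two distinct places of degree `d` are separated by an element that is integral at all places of
degree `d`. If `z` lies in the valuation ring of the first place only, then
`(1 - z + z ^ (q ^ d))⁻¹` has residue `1` or `0` at a place of degree `d` according to whether `z`
is integral there or not. -/
theorem Place.exists_separating (hF : IsFunctionField k F) {P Q : Place k F} (hPQ : P ≠ Q) {d : ℕ}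
    (hP : P.degree = d) : ∃ h : F,
    (∀ R : Place k F, R.degree = d → h ∈ R.toValuationSubring) ∧
      P.toValuationSubring.valuation h = 1 ∧ h ∈ Q.toValuationSubring.nonunits := by
  obtain ⟨z, hzP, hzQ⟩ : ∃ z, z ∈ P.toValuationSubring ∧ z ∉ Q.toValuationSubring := by
    by_contra! h
    exact hPQ (Place.ext (P.eq_of_le hF h Q.ne_top))
  have hd : 1 < Nat.card k ^ d :=
    Nat.one_lt_pow (hP ▸ (P.degree_pos hF).ne') Finite.one_lt_card
  have hin : ∀ R : Place k F, R.degree = d → z ∈ R.toValuationSubring →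
      R.toValuationSubring.valuation (1 + (z ^ Nat.card k ^ d - z))⁻¹ = 1 := by
    intro R hR hz
    have h1 := R.toValuationSubring.mem_nonunits_iff.1
      (R.pow_sub_self_mem_nonunits hF hR.dvd hz)
    rw [map_inv₀, inv_eq_one, ← map_one R.toValuationSubring.valuation]
    rw [← map_one R.toValuationSubring.valuation] at h1
    exact Valuation.map_add_eq_of_lt_left _ h1
  have hout : ∀ R : Place k F, z ∉ R.toValuationSubring →
      R.toValuationSubring.valuation (1 + (z ^ Nat.card k ^ d - z))⁻¹ < 1 := by
    intro R hz
    rw [← R.toValuationSubring.valuation_le_one_iff, not_le] at hz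
    set v := R.toValuationSubring.valuation
    have h1 : v (1 - z) < v (z ^ Nat.card k ^ d) := by
      refine lt_of_le_of_lt (v.map_sub 1 z) ?_
      rw [map_one, max_eq_right hz.le, map_pow]
      exact lt_self_pow₀ hz hd
    have h2 : 1 + (z ^ Nat.card k ^ d - z) = (1 - z) + z ^ Nat.card k ^ d := by ring
    rw [h2, map_inv₀, Valuation.map_add_eq_of_lt_right _ h1, map_pow]
    exact inv_lt_one_of_one_lt₀ (one_lt_pow₀ hz (by omega))
  refine ⟨(1 + (z ^ Nat.card k ^ d - z))⁻¹, fun R hR => ?_, hin P hP hzP,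
    Q.toValuationSubring.mem_nonunits_iff.2 (hout Q hzQ)⟩
  rw [← R.toValuationSubring.valuation_le_one_iff]
  by_cases hz : z ∈ R.toValuationSubring
  · exact (hin R hR hz).le
  · exact (hout R hz).le

/-- A transcendental `t` has finitely many zeros of degree `d`. Given more than `[F : k(t)]` of them,
products of separating elements have residues `δ_{PQ}` there, so that no relation over `k[t]` with a
coefficient that is nonzero at `t = 0` can hold between them. -/
theorem Place.finite_setOf_mem_nonunits (hF : IsFunctionField k F) {t : F}
    (ht : Transcendental k t) (d : ℕ) :
    {P : Place k F | P.degree = d ∧ t ∈ P.toValuationSubring.nonunits}.Finite := by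
  classical
  obtain ⟨n, hn⟩ := hF.exists_relation ht
  by_contra hinf
  obtain ⟨s, hs, hcard⟩ := Set.Infinite.exists_subset_card_eq hinf (n + 1)
  have hsep : ∀ P Q : s, P ≠ Q → ∃ h : F,
      (∀ R : Place k F, R.degree = d → h ∈ R.toValuationSubring) ∧
      P.1.toValuationSubring.valuation h = 1 ∧ h ∈ Q.1.toValuationSubring.nonunits := fun P Q h =>
    Place.exists_separating hF (fun e => h (Subtype.ext e)) (hs P.2).1
  choose! h hmem hone hnon using hsep
  obtain ⟨a, ha, P, hP⟩ := hn s (fun P => ∏ Q ∈ Finset.univ.erase P, h P Q)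
    (by rw [Fintype.card_coe, hcard]; exact n.lt_succ_self)
  set v := P.1.toValuationSubring.valuation with hv
  have htP : v t < 1 := (hs P.2).2
  have hpoly : ∀ p : k[X], v (aeval t p) ≤ 1 := fun p =>
    (P.1.toValuationSubring.valuation_le_one_iff _).2 (by
      have : aeval t p = ((aeval (⟨t, P.1.toValuationSubring.nonunits_subset (hs P.2).2⟩ :
        P.1.toValuationSubring) p : P.1.toValuationSubring) : F) :=
        aeval_algebraMap_apply F (⟨t, _⟩ : P.1.toValuationSubring) p
      rw [this]
      exact Subtype.coe_prop _)
  have hunit : v (aeval t (a P)) = 1 := by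
    have hc : v (algebraMap k F ((a P).coeff 0)) = 1 := by
      have h1 := (P.1.toValuationSubring.valuation_le_one_iff _).2
        (P.1.algebraMap_mem ((a P).coeff 0))
      have h2 := (P.1.toValuationSubring.valuation_le_one_iff _).2
        (P.1.algebraMap_mem ((a P).coeff 0)⁻¹)
      rw [map_inv₀, map_inv₀] at h2
      refine le_antisymm h1 ?_
      have h3 : v (algebraMap k F ((a P).coeff 0)) ≠ 0 := by
        rw [Valuation.ne_zero_iff]
        simpa using hP
      exact (inv_le_one₀ (zero_lt_iff.2 h3)).1 h2
    have hlt : v (aeval t (a P).divX * t) < v (algebraMap k F ((a P).coeff 0)) := by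
      rw [hc, map_mul]
      exact mul_lt_one_of_nonneg_of_lt_one_right (hpoly _) zero_le htP
    conv_lhs => rw [← divX_mul_X_add (a P), map_add, map_mul, aeval_X, aeval_C]
    rw [Valuation.map_add_eq_of_lt_right _ hlt, hc]
  -- modulo the maximal ideal of `P` only the term of `P` survives, and that term is a unit
  rw [← Finset.add_sum_erase _ _ (Finset.mem_univ P)] at ha
  have hfirst : v (aeval t (a P) * ∏ Q ∈ Finset.univ.erase P, h P Q) = 1 := by
    rw [map_mul, hunit, one_mul, map_prod]
    exact Finset.prod_eq_one fun Q hQ => hone P Q (Finset.ne_of_mem_erase hQ).symm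
  have hrest : v (∑ R ∈ Finset.univ.erase P,
      aeval t (a R) * ∏ Q ∈ Finset.univ.erase R, h R Q) < 1 := by
    refine Valuation.map_sum_lt _ one_ne_zero fun R hR => ?_
    have hRP := Finset.ne_of_mem_erase hR
    rw [← Finset.mul_prod_erase _ _ (Finset.mem_erase.2 ⟨hRP.symm, Finset.mem_univ P⟩), map_mul,
      map_mul, map_prod]
    refine mul_lt_one_of_nonneg_of_lt_one_right (hpoly _) zero_le
      (mul_lt_one_of_nonneg_of_lt_one_left zero_le (hnon R P hRP)
      (Finset.prod_le_one' fun Q hQ => ?_))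
    have hQR := Finset.ne_of_mem_erase (Finset.mem_of_mem_erase hQ)
    exact (P.1.toValuationSubring.valuation_le_one_iff _).2 (hmem R Q hQR.symm P (hs P.2).1)
  rw [add_eq_zero_iff_eq_neg] at ha
  rw [ha, Valuation.map_neg] at hfirst
  exact hrest.ne hfirst

/-- There are finitely many places of degree `d`: each one is a zero of `x ^ (q ^ d) - x` or of
`x⁻¹`. -/
theorem Place.finite_setOf_degree_eq (hF : IsFunctionField k F) (d : ℕ) :
    {P : Place k F | P.degree = d}.Finite := by
  obtain ⟨x, hx, -⟩ := hF.exists_finite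
  rcases Nat.eq_zero_or_pos d with rfl | hd
  · convert Set.finite_empty (α := Place k F)
    ext P
    simpa using (P.degree_pos hF).ne'
  have hq : 1 < Nat.card k ^ d := Nat.one_lt_pow hd.ne' Finite.one_lt_card
  have hy : Transcendental k (x ^ Nat.card k ^ d - x) := by
    have hdeg : (X ^ Nat.card k ^ d - X : k[X]).natDegree = Nat.card k ^ d := by
      rw [natDegree_sub_eq_left_of_natDegree_lt (by simpa using hq), natDegree_X_pow]
    have := hx.aeval (X ^ Nat.card k ^ d - X) (by omega) (mem_nonZeroDivisors_of_ne_zero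
      (leadingCoeff_ne_zero.2 fun h => by rw [h, natDegree_zero] at hdeg; omega))
    simpa using this
  have hx' : Transcendental k x⁻¹ := fun h => hx (by simpa using h.inv)
  refine ((Place.finite_setOf_mem_nonunits hF hy d).union
    (Place.finite_setOf_mem_nonunits hF hx' d)).subset fun P hP => ?_
  by_cases hxP : x ∈ P.toValuationSubring
  · exact Or.inl ⟨hP, P.pow_sub_self_mem_nonunits hF (Eq.dvd hP) hxP⟩
  · exact Or.inr ⟨hP, P.toValuationSubring.inv_mem_nonunits_iff.2 (Or.inr hxP)⟩

end Finite

end General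

/-! ### Riemann-Roch spaces -/

/-- A proper ideal of a subring of a field is contained in the maximal ideal of some valuation ring
containing the subring. -/
theorem exists_valuationSubring_of_injective {R E : Type*} [CommRing R] [Field E] {f : R →+* E}
    (hf : Function.Injective f) {I : Ideal R} (hI : I ≠ ⊤) :
    ∃ V : ValuationSubring E, (∀ r, f r ∈ V) ∧ ∀ r ∈ I, f r ∈ V.nonunits := by
  let e : R ≃+* f.range := RingEquiv.ofBijective f.rangeRestrict
    ⟨fun a b h => hf (congrArg Subtype.val h), f.rangeRestrict_surjective⟩
  obtain ⟨V, hV, hVI⟩ := (I.comap (e.symm : f.range →+* R)).image_subset_nonunits_valuationSubring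
    (fun h => hI (by
      rw [Ideal.eq_top_iff_one] at h ⊢
      simpa using h))
  refine ⟨V, fun r => hV ⟨r, rfl⟩, fun r hr => hVI ⟨e r, ?_, rfl⟩⟩
  simpa using hr

section General

variable {k F : Type*} [Field k] [Field F] [Algebra k F]

/-- An element without poles is algebraic over the constants: if `x` is transcendental then a
valuation ring dominating `k[x⁻¹]` at `(x⁻¹)` does not contain `x`. -/
theorem isAlgebraic_of_forall_mem {x : F} (hx : ∀ P : Place k F, x ∈ P.toValuationSubring) :
    IsAlgebraic k x := by
  by_contra hxt
  have hx0 : x ≠ 0 := fun h => hxt (h ▸ isAlgebraic_zero)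
  have ht : Transcendental k x⁻¹ := fun h => hxt (by simpa using h.inv)
  obtain ⟨V, hV, hVI⟩ := exists_valuationSubring_of_injective
    (f := (aeval (R := k) x⁻¹).toRingHom) (transcendental_iff_injective.1 ht)
    (I := Ideal.span {X}) (fun h => not_isUnit_X (Ideal.span_singleton_eq_top.1 h))
  have hxV : x ∉ V := by
    have := hVI X (Ideal.mem_span_singleton_self X)
    simp only [AlgHom.toRingHom_eq_coe, RingHom.coe_coe, aeval_X] at this
    exact (V.inv_mem_nonunits_iff.1 this).resolve_left hx0
  exact hxV (hx ⟨V, fun a => by simpa using hV (C a), fun h => hxV (h ▸ ValuationSubring.mem_top x)⟩)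

theorem Divisor.degree_zero : (0 : Divisor k F).degree = 0 := rfl

theorem Divisor.degree_add (A B : Divisor k F) : (A + B).degree = A.degree + B.degree :=
  Finsupp.sum_add_index' (fun _ => by simp) fun _ _ _ => add_mul _ _ _

theorem Divisor.degree_single (P : Place k F) (n : ℤ) :
    Divisor.degree (Finsupp.single P n) = n * P.degree :=
  Finsupp.sum_single_index (by simp)

theorem Place.mul_zpow_mem_iff (P : Place k F) {t t' : P.toValuationSubring} (ht : Irreducible t)
    (ht' : Irreducible t') (hF : IsFunctionField k F) (n : ℤ) (x : F) :
    x * (t : F) ^ n ∈ P.toValuationSubring ↔ x * (t' : F) ^ n ∈ P.toValuationSubring := by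
  have := P.isDiscreteValuationRing hF
  have h : P.toValuationSubring.valuation (t : F) = P.toValuationSubring.valuation (t' : F) := by
    obtain ⟨u, hu⟩ := IsDiscreteValuationRing.associated_of_irreducible _ ht' ht
    refine (P.toValuationSubring.valuation_eq_iff _ _).2 ⟨u, ?_⟩
    rw [← hu]
    exact mul_comm _ _
  rw [← P.toValuationSubring.valuation_le_one_iff, ← P.toValuationSubring.valuation_le_one_iff,
    map_mul, map_mul, map_zpow₀, map_zpow₀, h]

theorem mem_riemannRochSpace_iff {A : Divisor k F} {x : F} : x ∈ riemannRochSpace A ↔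
    ∀ (P : Place k F) (t : P.toValuationSubring), Irreducible t →
      x * (t : F) ^ A P ∈ P.toValuationSubring := by
  refine forall_congr' fun P => forall_congr' fun t => forall_congr' fun ht => ?_
  have h0 : (t : F) ≠ 0 := fun h => ht.ne_zero (Subtype.ext h)
  have hv : 0 < P.toValuationSubring.valuation (t : F) := by
    rw [zero_lt_iff, Valuation.ne_zero_iff]; exact h0
  rw [← P.toValuationSubring.valuation_le_one_iff, map_mul, map_zpow₀, zpow_neg,
    ← le_mul_inv_iff₀ (zpow_pos hv _), one_mul]

theorem riemannRochSpace_mono {A B : Divisor k F} (h : A ≤ B) :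
    riemannRochSpace A ≤ riemannRochSpace B := by
  intro x hx P t ht
  have h0 : (t : F) ≠ 0 := fun h => ht.ne_zero (Subtype.ext h)
  refine (hx P t ht).trans (zpow_le_zpow_right_of_le_one₀ ?_ (P.toValuationSubring.valuation_le_one t)
    (neg_le_neg (h P)))
  rw [zero_lt_iff, Valuation.ne_zero_iff]
  exact h0

/-- The Riemann-Roch space in terms of one chosen uniformizer at every place. -/
theorem mem_riemannRochSpace_iff_of_irreducible (hF : IsFunctionField k F)
    {t : ∀ P : Place k F, P.toValuationSubring} (ht : ∀ P, Irreducible (t P)) {A : Divisor k F}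
    {x : F} : x ∈ riemannRochSpace A ↔
      ∀ P : Place k F, x * (t P : F) ^ A P ∈ P.toValuationSubring :=
  mem_riemannRochSpace_iff.trans <| forall_congr' fun P =>
    ⟨fun h => h _ (ht P), fun h _ hs => (P.mul_zpow_mem_iff hs (ht P) hF _ _).2 h⟩

theorem Place.exists_irreducible (hF : IsFunctionField k F) (P : Place k F) :
    ∃ t : P.toValuationSubring, Irreducible t := by
  have := P.isDiscreteValuationRing hF
  exact IsDiscreteValuationRing.exists_irreducible _

theorem Place.coe_mem_nonunits_of_irreducible (P : Place k F) {t : P.toValuationSubring}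
    (ht : Irreducible t) : (t : F) ∈ P.toValuationSubring.nonunits :=
  P.toValuationSubring.coe_mem_nonunits_iff.2 ht.1

theorem Place.exists_eq_mul_of_mem_nonunits (hF : IsFunctionField k F) (P : Place k F)
    {t : P.toValuationSubring} (ht : Irreducible t) {x : F}
    (hx : x ∈ P.toValuationSubring.nonunits) : ∃ y ∈ P.toValuationSubring, x = t * y := by
  have := P.isDiscreteValuationRing hF
  obtain ⟨hxm, hx'⟩ := P.toValuationSubring.mem_nonunits_iff_exists_mem_maximalIdeal.1 hx
  rw [ht.maximalIdeal_eq, Ideal.mem_span_singleton] at hx'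
  obtain ⟨y, hy⟩ := hx'
  exact ⟨y, y.2, congrArg Subtype.val hy⟩

theorem finrank_le_of_ker_le {V W : Submodule k F} {M : Type*} [AddCommGroup M] [Module k M]
    [FiniteDimensional k W] [FiniteDimensional k M] (φ : V →ₗ[k] M)
    (h : ∀ x, φ x = 0 → (x : F) ∈ W) :
    FiniteDimensional k V ∧
      Module.finrank k V ≤ Module.finrank k W + Module.finrank k M := by
  let f : LinearMap.ker φ →ₗ[k] W :=
    (V.subtype.comp (LinearMap.ker φ).subtype).codRestrict W fun x => h _ x.2
  have hf : Function.Injective f := fun x y hxy =>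
    Subtype.ext (Subtype.ext (Subtype.ext_iff.1 hxy :))
  have hker : FiniteDimensional k (LinearMap.ker φ) := Module.Finite.of_injective f hf
  have hV : FiniteDimensional k V := by
    refine Module.finite_def.2 (Submodule.fg_of_fg_map_of_fg_inf_ker φ ?_ ?_)
    · exact (IsNoetherian.noetherian (R := k) (M := M) _)
    · rw [top_inf_eq]
      exact Module.Finite.iff_fg.1 hker
  refine ⟨hV, ?_⟩
  rw [← LinearMap.finrank_range_add_finrank_ker φ, add_comm]
  exact add_le_add (LinearMap.finrank_le_finrank_of_injective hf) (Submodule.finrank_le _)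

/-- `dim L(A + P) ≤ dim L(A) + deg P`: the kernel of `x ↦ x t ^ (A(P) + 1)`, as a map from `L(A + P)`
to the residue field at `P`, is `L(A)`. -/
theorem finrank_riemannRochSpace_add_single_le (hF : IsFunctionField k F) (A : Divisor k F)
    (P : Place k F) [FiniteDimensional k (riemannRochSpace A)] :
    FiniteDimensional k (riemannRochSpace (A + Finsupp.single P 1)) ∧
      Module.finrank k (riemannRochSpace (A + Finsupp.single P 1)) ≤
        Module.finrank k (riemannRochSpace A) + P.degree := by
  classical
  choose t ht using fun P : Place k F => P.exists_irreducible hF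
  have := P.finiteDimensional_residueField hF
  have hmem : ∀ x : riemannRochSpace (A + Finsupp.single P 1),
      (x : F) * (t P : F) ^ (A P + 1) ∈ P.toValuationSubring := fun x => by
    simpa using (mem_riemannRochSpace_iff_of_irreducible hF ht).1 x.2 P
  have ht0 : (t P : F) ≠ 0 := fun h => (ht P).ne_zero (Subtype.ext h)
  let φ : riemannRochSpace (A + Finsupp.single P 1) →ₗ[k]
      IsLocalRing.ResidueField P.toValuationSubring :=
    { toFun := fun x => IsLocalRing.residue _ ⟨_, hmem x⟩
      map_add' := fun x y => by
        rw [← map_add]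
        exact congrArg _ (Subtype.ext (add_mul _ _ _))
      map_smul' := fun c x => by
        rw [RingHom.id_apply, ← IsLocalRing.ResidueField.algebraMap_eq, Algebra.smul_def,
          IsScalarTower.algebraMap_apply k P.toValuationSubring
            (IsLocalRing.ResidueField P.toValuationSubring), ← map_mul]
        refine congrArg _ (Subtype.ext ?_)
        change (c • (x : F)) * _ = algebraMap k F c * (_ * _)
        rw [Algebra.smul_def, mul_assoc] }
  refine finrank_le_of_ker_le φ fun x hx => ?_
  rw [mem_riemannRochSpace_iff_of_irreducible hF ht]
  intro Q
  by_cases hQ : Q = P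
  · subst hQ
    have h1 : (x : F) * (t Q : F) ^ (A Q + 1) ∈ Q.toValuationSubring.nonunits :=
      Q.toValuationSubring.coe_mem_nonunits_iff.2 ((IsLocalRing.residue_eq_zero_iff _).1 hx)
    obtain ⟨y, hy, hxy⟩ := Q.exists_eq_mul_of_mem_nonunits hF (ht Q) h1
    rw [zpow_add_one₀ ht0, ← mul_assoc, mul_comm, mul_right_inj' ht0] at hxy
    rwa [hxy]
  · have := (mem_riemannRochSpace_iff_of_irreducible hF ht).1 x.2 Q
    simpa [Finsupp.single_apply, Ne.symm hQ] using this

/-- `L(0)` is the field of constants. -/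
theorem finiteDimensional_riemannRochSpace_zero (hF : IsFunctionField k F) :
    FiniteDimensional k (riemannRochSpace (0 : Divisor k F)) := by
  choose t ht using fun P : Place k F => P.exists_irreducible hF
  have hle : riemannRochSpace (0 : Divisor k F) ≤
      (⊥ : IntermediateField k F).toSubalgebra.toSubmodule := by
    intro x hx
    have hx' : IsAlgebraic k x := isAlgebraic_of_forall_mem fun P => by
      simpa using (mem_riemannRochSpace_iff_of_irreducible hF ht).1 hx P
    have h : x ∈ algebraicClosure k F := mem_algebraicClosure_iff.2 hx'
    rwa [hF.algebraicClosure_eq_bot] at h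
  have : FiniteDimensional k (⊥ : IntermediateField k F).toSubalgebra.toSubmodule :=
    inferInstanceAs (FiniteDimensional k (⊥ : IntermediateField k F))
  exact Submodule.finiteDimensional_of_le hle

/-- `dim L(A + D) ≤ dim L(A) + deg D` for an effective divisor `D`, which is given by its natural
number coefficients so that it can be built up one place at a time. -/
theorem finrank_riemannRochSpace_add_le (hF : IsFunctionField k F) (D : Place k F →₀ ℕ) :
    ∀ A : Divisor k F, FiniteDimensional k (riemannRochSpace A) →
      FiniteDimensional k
        (riemannRochSpace (A + Finsupp.mapRange.addMonoidHom (Nat.castAddMonoidHom ℤ) D)) ∧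
      (Module.finrank k
        (riemannRochSpace (A + Finsupp.mapRange.addMonoidHom (Nat.castAddMonoidHom ℤ) D)) : ℤ) ≤
        Module.finrank k (riemannRochSpace A) +
          Divisor.degree (Finsupp.mapRange.addMonoidHom (Nat.castAddMonoidHom ℤ) D) := by
  induction D using Finsupp.induction_linear with
  | zero =>
    intro A hA
    rw [map_zero, add_zero, Divisor.degree_zero]
    exact ⟨hA, by simp⟩
  | add D D' hD hD' =>
    intro A hA
    obtain ⟨h1, h2⟩ := hD A hA
    obtain ⟨h3, h4⟩ := hD' _ h1
    rw [map_add, ← add_assoc, Divisor.degree_add]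
    exact ⟨h3, by linarith⟩
  | single P n =>
    induction n with
    | zero =>
      intro A hA
      rw [Finsupp.single_zero, map_zero, add_zero, Divisor.degree_zero]
      exact ⟨hA, by simp⟩
    | succ n ih =>
      intro A hA
      obtain ⟨h1, h2⟩ := ih A hA
      obtain ⟨h3, h4⟩ := finrank_riemannRochSpace_add_single_le hF
        (A + Finsupp.mapRange.addMonoidHom (Nat.castAddMonoidHom ℤ) (Finsupp.single P n)) P
      have h5 : Finsupp.mapRange.addMonoidHom (Nat.castAddMonoidHom ℤ) (Finsupp.single P 1) =
          (Finsupp.single P 1 : Divisor k F) := by simp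
      rw [Finsupp.single_add, map_add, h5, ← add_assoc, Divisor.degree_add, Divisor.degree_single]
      refine ⟨h3, ?_⟩
      have : (Module.finrank k _ : ℤ) ≤ _ := Int.ofNat_le.2 h4
      push_cast at this
      linarith

theorem exists_eq_add_of_le {A B : Divisor k F} (h : A ≤ B) : ∃ D : Place k F →₀ ℕ,
    B = A + Finsupp.mapRange.addMonoidHom (Nat.castAddMonoidHom ℤ) D :=
  ⟨(B - A).mapRange Int.toNat rfl, by
    ext P
    have := h P
    simp
    omega⟩

theorem finiteDimensional_riemannRochSpace (hF : IsFunctionField k F) (A : Divisor k F) :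
    FiniteDimensional k (riemannRochSpace A) := by
  -- `L(A)` lies in `L(A⁺)`, which is obtained from `L(0)` in finitely many steps
  obtain ⟨D, hD⟩ := exists_eq_add_of_le (le_sup_right : (0 : Divisor k F) ≤ A ⊔ 0)
  have h1 := (finrank_riemannRochSpace_add_le hF D 0
    (finiteDimensional_riemannRochSpace_zero hF)).1
  rw [← hD] at h1
  exact Submodule.finiteDimensional_of_le (riemannRochSpace_mono (le_sup_left : A ≤ A ⊔ 0))

/-- `deg A - dim L(A)` is monotone in `A`. -/
theorem degree_sub_finrank_le_of_le (hF : IsFunctionField k F) {A B : Divisor k F} (h : A ≤ B) :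
    A.degree - Module.finrank k (riemannRochSpace A) ≤
      B.degree - Module.finrank k (riemannRochSpace B) := by
  obtain ⟨D, rfl⟩ := exists_eq_add_of_le h
  have h2 := (finrank_riemannRochSpace_add_le hF D A
    (finiteDimensional_riemannRochSpace hF A)).2
  rw [Divisor.degree_add]
  linarith

end General

/-! ### Counting points -/

section General

variable {k F : Type*} [Field k] [Field F] [Algebra k F]

theorem Place.finite_setOf_degree_dvd [Finite k] (hF : IsFunctionField k F) {n : ℕ} (hn : n ≠ 0) :
    {P : Place k F | P.degree ∣ n}.Finite := by
  refine ((n.divisors.finite_toSet).biUnion fun d _ =>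
    Place.finite_setOf_degree_eq hF d).subset fun P hP => ?_
  exact Set.mem_biUnion (Finset.mem_coe.2 (Nat.mem_divisors.2 ⟨hP, hn⟩)) rfl

/-- The number of points of `F / k` with values in a finite extension `L / k` of degree `n` is
`∑_{d ∣ n} d * B_d(F / k)`, since a place of degree `d` carries `d` points if `d ∣ n`, and none
otherwise. -/
theorem card_points [Finite k] (hF : IsFunctionField k F) (L : Type*) [Field L] [Algebra k L]
    [FiniteDimensional k L] :
    Nat.card (Σ P : Place k F, IsLocalRing.ResidueField P.toValuationSubring →ₐ[k] L) =
      ∑ d ∈ (Module.finrank k L).divisors, d * numPlaces k F d := by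
  classical
  have : Finite L := Module.finite_of_finite k
  set n := Module.finrank k L with hn
  have hn0 : n ≠ 0 := Module.finrank_pos.ne'
  -- places of a given degree are finite in number, so `numPlaces` is not the default value `0`
  have hT := Place.finite_setOf_degree_dvd hF hn0
  have hdvd : ∀ (P : Place k F),
      (IsLocalRing.ResidueField P.toValuationSubring →ₐ[k] L) → P.degree ∣ n := fun P φ =>
    FiniteField.nonempty_algHom_iff_finrank_dvd.1 ⟨φ⟩
  have hcard : ∀ P : Place k F, P.degree ∣ n →
      Nat.card (IsLocalRing.ResidueField P.toValuationSubring →ₐ[k] L) = P.degree := fun P hP =>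
    FiniteField.natCard_algHom_of_finrank_dvd hP
  let e : (Σ P : Place k F, IsLocalRing.ResidueField P.toValuationSubring →ₐ[k] L) ≃
      Σ P : hT.toFinset, IsLocalRing.ResidueField P.1.toValuationSubring →ₐ[k] L :=
    { toFun := fun x => ⟨⟨x.1, hT.mem_toFinset.2 (hdvd x.1 x.2)⟩, x.2⟩
      invFun := fun x => ⟨x.1.1, x.2⟩
      left_inv := fun _ => rfl
      right_inv := fun _ => rfl }
  have hfin : ∀ P : hT.toFinset,
      Finite (IsLocalRing.ResidueField P.1.toValuationSubring →ₐ[k] L) := fun P =>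
    Nat.finite_of_card_ne_zero (by
      rw [hcard P.1 (hT.mem_toFinset.1 P.2)]
      exact (P.1.degree_pos hF).ne')
  rw [Nat.card_congr e, Nat.card_sigma,
    Finset.sum_congr rfl fun P _ => hcard P.1 (hT.mem_toFinset.1 P.2),
    Finset.sum_coe_sort hT.toFinset fun P => P.degree,
    ← Finset.sum_fiberwise_of_maps_to (t := n.divisors) (g := fun P => P.degree)
      fun P hP => Nat.mem_divisors.2 ⟨hT.mem_toFinset.1 hP, hn0⟩]
  refine Finset.sum_congr rfl fun d hd => ?_
  rw [Finset.sum_congr rfl fun P hP => (Finset.mem_filter.1 hP).2, Finset.sum_const, smul_eq_mul,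
    mul_comm, numPlaces, ← Set.ncard_coe_finset]
  congr 2
  ext P
  have := Nat.dvd_of_mem_divisors hd
  simp only [Finset.coe_filter, Set.Finite.mem_toFinset, Set.mem_ofPred_eq, and_iff_right_iff_imp]
  rintro rfl
  exact this

end General

/-! ### Constant field extensions -/

section Extension

variable {k k' F E : Type*} [Field k] [Field k'] [Field F] [Field E] [Algebra k k'] [Algebra k F]
  [Algebra k E] [Algebra k' E] [Algebra F E] [IsScalarTower k k' E] [IsScalarTower k F E]

/-- Minimal polynomials of constants do not change under extension of the base field from `k` to a
field in which `k` is algebraically closed. -/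
theorem minpoly_algebraMap_eq (hc : algebraicClosure k F = ⊥) [FiniteDimensional k k'] (γ : k') :
    minpoly F (algebraMap k' E γ) = (minpoly k γ).map (algebraMap k F) := by
  have hγ : IsIntegral k γ := IsIntegral.of_finite k γ
  have hγE : IsIntegral F (algebraMap k' E γ) := (hγ.map (IsScalarTower.toAlgHom k k' E)).tower_top
  have hdvd : minpoly F (algebraMap k' E γ) ∣ (minpoly k γ).map (algebraMap k F) := by
    refine minpoly.dvd _ _ ?_
    rw [aeval_map_algebraMap, aeval_algebraMap_apply, minpoly.aeval, map_zero]
  have hlift := integralClosure.mem_lifts_of_monic_of_dvd_map F (minpoly.monic hγ)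
    (minpoly.monic hγE) hdvd
  obtain ⟨h, hh⟩ : minpoly F (algebraMap k' E γ) ∈ lifts (algebraMap k F) := by
    rw [lifts_iff_coeff_lifts] at hlift ⊢
    intro n
    obtain ⟨⟨c, hci⟩, hc'⟩ := hlift n
    have h1 : c ∈ algebraicClosure k F := mem_algebraicClosure_iff.2 (IsIntegral.isAlgebraic hci)
    rw [hc] at h1
    rw [← hc']
    exact h1
  rw [coe_mapRingHom] at hh
  have hdvd' : (minpoly k γ).map (algebraMap k F) ∣ minpoly F (algebraMap k' E γ) := by
    rw [← hh]
    refine Polynomial.map_dvd _ (minpoly.dvd _ _ ((algebraMap k' E).injective ?_))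
    rw [map_zero, ← aeval_algebraMap_apply, ← aeval_map_algebraMap F, hh, minpoly.aeval]
  exact eq_of_monic_of_associated (minpoly.monic hγE) ((minpoly.monic hγ).map _)
    (associated_of_dvd_dvd hdvd hdvd')

/-- `F` and `k'` are linearly disjoint over `k`: the powers of a primitive element of `k' / k` form a
basis both of `k' / k` and of `E / F`. -/
theorem IsConstantFieldExtension.exists_basis [Finite k] (hc : algebraicClosure k F = ⊥)
    [FiniteDimensional k k'] (hE : IsConstantFieldExtension k k' F E) :
    ∃ (b : Module.Basis (Fin (Module.finrank k k')) k k')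
      (bE : Module.Basis (Fin (Module.finrank k k')) F E), ∀ j, bE j = algebraMap k' E (b j) := by
  obtain ⟨γ, hγ⟩ := Field.exists_primitive_element k k'
  have hint : IsIntegral k γ := IsIntegral.of_finite k γ
  have hintE : IsIntegral F (algebraMap k' E γ) :=
    (hint.map (IsScalarTower.toAlgHom k k' E)).tower_top
  have htop : F⟮algebraMap k' E γ⟯ = ⊤ := by
    rw [← top_le_iff, ← show _ = ⊤ from hE, adjoin_le_iff]
    rintro _ ⟨y, rfl⟩
    have hy : y ∈ k⟮γ⟯ := hγ ▸ mem_top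
    obtain ⟨r, s, rfl⟩ := (mem_adjoin_simple_iff k y).1 hy
    refine (mem_adjoin_simple_iff F _).2
      ⟨r.map (algebraMap k F), s.map (algebraMap k F), ?_⟩
    rw [aeval_map_algebraMap, aeval_map_algebraMap, aeval_algebraMap_apply,
      aeval_algebraMap_apply, map_div₀]
  have hdeg : (minpoly k γ).natDegree = Module.finrank k k' := by
    rw [← adjoin.finrank hint, hγ, finrank_top']
  have hdegE : (minpoly F (algebraMap k' E γ)).natDegree = Module.finrank k k' := by
    rw [minpoly_algebraMap_eq hc, natDegree_map, hdeg]
  have hfinE : Module.finrank F E = Module.finrank k k' := by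
    rw [← hdegE, ← adjoin.finrank hintE, htop, finrank_top']
  have hli := linearIndependent_pow (K := k) γ
  have hliE := linearIndependent_pow (K := F) (algebraMap k' E γ)
  rw [hdeg] at hli
  rw [hdegE] at hliE
  have : Nonempty (Fin (Module.finrank k k')) := ⟨⟨0, Module.finrank_pos⟩⟩
  refine ⟨basisOfLinearIndependentOfCardEqFinrank hli (by simp),
    basisOfLinearIndependentOfCardEqFinrank hliE (by simp [hfinE]), fun j => by simp⟩

theorem IsConstantFieldExtension.finrank_eq [Finite k] (hc : algebraicClosure k F = ⊥)
    [FiniteDimensional k k'] (hE : IsConstantFieldExtension k k' F E) :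
    Module.finrank F E = Module.finrank k k' := by
  obtain ⟨-, bE, -⟩ := hE.exists_basis hc
  simpa using Module.finrank_eq_card_basis bE

theorem IsConstantFieldExtension.isFunctionField [Finite k] (hF : IsFunctionField k F)
    [FiniteDimensional k k'] (hE : IsConstantFieldExtension k k' F E) :
    IsFunctionField k' E := by
  have hc := hF.algebraicClosure_eq_bot
  have hfin : FiniteDimensional F E :=
    Module.finite_of_finrank_pos (by rw [hE.finrank_eq hc]; exact Module.finrank_pos)
  refine ⟨?_, ?_⟩
  · obtain ⟨x, hx, hxfin⟩ := hF.exists_finite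
    refine ⟨algebraMap F E x, fun h => ?_, ?_⟩
    · have h1 : IsAlgebraic k (algebraMap F E x) := h.restrictScalars k
      exact hx ((isAlgebraic_algebraMap_iff (algebraMap F E).injective).1 h1)
    · have hmem : ∀ y : k⟮x⟯, algebraMap F E y ∈ k'⟮algebraMap F E x⟯ := by
        rintro ⟨y, hy⟩
        obtain ⟨r, s, rfl⟩ := (mem_adjoin_simple_iff k y).1 hy
        refine (mem_adjoin_simple_iff k' _).2
          ⟨r.map (algebraMap k k'), s.map (algebraMap k k'), ?_⟩
        rw [aeval_map_algebraMap, aeval_map_algebraMap, aeval_algebraMap_apply,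
          aeval_algebraMap_apply, map_div₀]
      let _ : Algebra k⟮x⟯ k'⟮algebraMap F E x⟯ :=
        (((algebraMap F E).comp (algebraMap k⟮x⟯ F)).codRestrict
          k'⟮algebraMap F E x⟯ hmem).toAlgebra
      have : IsScalarTower k⟮x⟯ k'⟮algebraMap F E x⟯ E :=
        IsScalarTower.of_algebraMap_eq fun y => rfl
      have : Module.Finite k⟮x⟯ E := Module.Finite.trans F E
      exact Module.Finite.of_restrictScalars_finite k⟮x⟯ k'⟮algebraMap F E x⟯ E
  · rw [eq_bot_iff]
    intro z hz
    -- `E` is also the constant field extension of `F` by the finite field `K = k'(z)`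
    have hz' : IsIntegral k' z := (mem_algebraicClosure_iff.1 hz).isIntegral
    let K := k'⟮z⟯
    have hK : FiniteDimensional k' K := adjoin.finiteDimensional hz'
    have hkK : FiniteDimensional k K := Module.Finite.trans k' K
    have hkKE : IsScalarTower k K E := IsScalarTower.of_algebraMap_eq fun c => by
      rw [IsScalarTower.algebraMap_apply k k' E, IsScalarTower.algebraMap_apply k k' K]
      rfl
    have hEK : IsConstantFieldExtension k K F E := by
      refine top_le_iff.1 ?_
      rw [← show _ = ⊤ from hE]
      refine adjoin.mono _ _ _ ?_
      rintro _ ⟨y, rfl⟩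
      exact ⟨algebraMap k' K y, rfl⟩
    have h1 := Module.finrank_mul_finrank k k' K
    rw [← hEK.finrank_eq hc, ← hE.finrank_eq hc] at h1
    have h2 : Module.finrank k' K = 1 := by
      refine Nat.eq_of_mul_eq_mul_left (Module.finrank_pos (R := F) (M := E)) ?_
      rw [h1, mul_one]
    have h3 : K = ⊥ := finrank_eq_one_iff.1 h2
    rw [← h3]
    exact mem_adjoin_simple_self k' z

end Extension

/-! ### The ring `k' ⊗ O_P` -/

section Extension

variable {k k' F E : Type*} [Field k] [Field k'] [Field F] [Field E] [Algebra k k'] [Algebra k F]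
  [Algebra k E] [Algebra k' E] [Algebra F E] [IsScalarTower k k' E] [IsScalarTower k F E]

variable (k F) in
/-- The place of `F / k` below a place of `E / k'`, given by the valuation ring `O ∩ F`. It is
proper because `E / F` is algebraic. -/
def Place.restrict [Algebra.IsIntegral F E] (Q : Place k' E) : Place k F where
  toValuationSubring := Q.toValuationSubring.comap (algebraMap F E)
  algebraMap_mem a := by
    rw [ValuationSubring.mem_comap, ← IsScalarTower.algebraMap_apply k F E,
      IsScalarTower.algebraMap_apply k k' E]
    exact Q.algebraMap_mem _
  ne_top h := Q.ne_top (top_le_iff.1 fun z _ =>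
    (⟨Q.toValuationSubring, fun x => ValuationSubring.mem_comap.1 (h ▸ ValuationSubring.mem_top x),
      Q.ne_top⟩ : Place F E).mem_of_isIntegral (Algebra.IsIntegral.isIntegral z))

theorem Place.mem_restrict [Algebra.IsIntegral F E] {Q : Place k' E} {x : F} :
    x ∈ (Q.restrict k F).toValuationSubring ↔ algebraMap F E x ∈ Q.toValuationSubring :=
  Iff.rfl

theorem Place.mem_nonunits_restrict [Algebra.IsIntegral F E] {Q : Place k' E} {x : F} :
    x ∈ (Q.restrict k F).toValuationSubring.nonunits ↔
      algebraMap F E x ∈ Q.toValuationSubring.nonunits := by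
  rw [ValuationSubring.mem_nonunits_iff_or, ValuationSubring.mem_nonunits_iff_or,
    Place.mem_restrict, map_inv₀, map_eq_zero]

variable (k' E) in
/-- The map `k' ⊗ O_P → E`. For a constant field extension it is injective, and its image is the
integral closure of `O_P` in `E`. -/
noncomputable def Place.tensorMap (P : Place k F) :
    k' ⊗[k] P.toValuationSubring →ₐ[k'] E :=
  Algebra.TensorProduct.lift (Algebra.ofId k' E)
    ((IsScalarTower.toAlgHom k F E).comp (IsScalarTower.toAlgHom k P.toValuationSubring F))
    fun _ _ => Commute.all _ _

@[simp]
theorem Place.tensorMap_tmul (P : Place k F) (x : k') (a : P.toValuationSubring) :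
    P.tensorMap k' E (x ⊗ₜ a) = algebraMap k' E x * algebraMap F E a :=
  rfl

theorem Place.tensorMap_mem [Algebra.IsIntegral F E] {P : Place k F} {Q : Place k' E}
    (h : Q.restrict k F = P) (y : k' ⊗[k] P.toValuationSubring) :
    P.tensorMap k' E y ∈ Q.toValuationSubring := by
  subst h
  induction y with
  | zero => simp
  | tmul x a => exact Q.toValuationSubring.mul_mem _ _ (Q.algebraMap_mem x) a.2
  | add x y hx hy => simpa using Q.toValuationSubring.add_mem _ _ hx hy

/-- An element of `k' ⊗ O_P`, and its image in `E`, in coordinates with respect to a basis of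
`k' / k`. -/
theorem Place.tensorMap_eq_sum {ι : Type*} [Fintype ι] (b : Module.Basis ι k k') (P : Place k F)
    (y : k' ⊗[k] P.toValuationSubring) : ∃ a : ι → P.toValuationSubring,
      y = ∑ j, b j ⊗ₜ a j ∧
      P.tensorMap k' E y = ∑ j, (a j : F) • algebraMap k' E (b j) := by
  classical
  have h : y = ∑ j, b j ⊗ₜ equivFinsuppOfBasisLeft b y j := by
    conv_lhs => rw [← (equivFinsuppOfBasisLeft b).symm_apply_apply y,
      equivFinsuppOfBasisLeft_symm_apply, Finsupp.sum_fintype _ _ (by simp)]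
  refine ⟨_, h, ?_⟩
  conv_lhs => rw [h]
  rw [map_sum]
  refine Finset.sum_congr rfl fun j _ => ?_
  rw [Place.tensorMap_tmul, Algebra.smul_def, mul_comm]

theorem Place.tensorMap_injective {ι : Type*} [Fintype ι] {b : Module.Basis ι k k'}
    {bE : Module.Basis ι F E} (hb : ∀ j, bE j = algebraMap k' E (b j)) (P : Place k F) :
    Function.Injective (P.tensorMap k' E) := by
  rw [injective_iff_map_eq_zero]
  intro y hy
  obtain ⟨a, ha, haE⟩ := P.tensorMap_eq_sum (E := E) b y
  simp_rw [hy, ← hb] at haE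
  have h0 := Fintype.linearIndependent_iff.1 bE.linearIndependent _ haE.symm
  rw [ha]
  exact Finset.sum_eq_zero fun j _ => by
    rw [show a j = 0 from Subtype.ext (h0 j), tmul_zero]

theorem Place.exists_pow_mul_mem (hF : IsFunctionField k F) (P : Place k F)
    {t : P.toValuationSubring} (ht : Irreducible t) (x : F) :
    ∃ n : ℕ, (t : F) ^ n * x ∈ P.toValuationSubring := by
  have := P.isDiscreteValuationRing hF
  by_cases hx : x ∈ P.toValuationSubring
  · exact ⟨0, by simpa using hx⟩
  have hx' := (P.toValuationSubring.mem_or_inv_mem x).resolve_left hx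
  have hx0 : x ≠ 0 := fun h => hx (h ▸ P.toValuationSubring.zero_mem)
  obtain ⟨n, u, hu⟩ := IsDiscreteValuationRing.eq_unit_mul_pow_irreducible
    (x := (⟨x⁻¹, hx'⟩ : P.toValuationSubring))
    (fun h => hx0 (inv_eq_zero.1 (congrArg Subtype.val h))) ht
  have hu' : x⁻¹ = ((u : P.toValuationSubring) : F) * (t : F) ^ n := congrArg Subtype.val hu
  have huu : (((u⁻¹ : P.toValuationSubringˣ) : P.toValuationSubring) : F) *
      ((u : P.toValuationSubring) : F) = 1 := congrArg Subtype.val u.inv_mul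
  refine ⟨n, ?_⟩
  have : (t : F) ^ n * x = (((u⁻¹ : P.toValuationSubringˣ) : P.toValuationSubring) : F) := by
    calc (t : F) ^ n * x = (((u⁻¹ : P.toValuationSubringˣ) : P.toValuationSubring) : F) *
        ((u : P.toValuationSubring) : F) * (t : F) ^ n * x := by rw [huu, one_mul]
      _ = (((u⁻¹ : P.toValuationSubringˣ) : P.toValuationSubring) : F) * (x⁻¹ * x) := by
        rw [hu']; ring
      _ = _ := by rw [inv_mul_cancel₀ hx0, mul_one]
  rw [this]
  exact Subtype.coe_prop _

/-- `E` is obtained from `k' ⊗ O_P` by inverting the uniformizer `t`. -/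
theorem Place.exists_pow_mul_eq_tensorMap (hF : IsFunctionField k F) {ι : Type*} [Fintype ι]
    {b : Module.Basis ι k k'} {bE : Module.Basis ι F E}
    (hb : ∀ j, bE j = algebraMap k' E (b j)) (P : Place k F)
    {t : P.toValuationSubring} (ht : Irreducible t) (z : E) :
    ∃ (n : ℕ) (y : k' ⊗[k] P.toValuationSubring),
      algebraMap F E t ^ n * z = P.tensorMap k' E y := by
  have hstep : ∀ z : E, ∀ n m : ℕ, ∀ y, algebraMap F E t ^ n * z = P.tensorMap k' E y →
      algebraMap F E t ^ (m + n) * z = P.tensorMap k' E ((1 ⊗ₜ t) ^ m * y) := by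
    intro z n m y h
    rw [map_mul, map_pow, ← h, Place.tensorMap_tmul, map_one, one_mul, pow_add, mul_assoc]
  rw [← bE.sum_repr z]
  refine Finset.sum_induction _ (fun z => ∃ (n : ℕ) (y : k' ⊗[k] P.toValuationSubring),
      algebraMap F E t ^ n * z = P.tensorMap k' E y) ?_ ⟨0, 0, by simp⟩ fun j _ => ?_
  · rintro z w ⟨n, y, hy⟩ ⟨m, y', hy'⟩
    have h1 := hstep z n m y hy
    have h2 := hstep w m n y' hy'
    rw [add_comm n m] at h2
    exact ⟨m + n, _, by rw [mul_add, h1, h2, ← map_add]⟩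
  · obtain ⟨n, hn⟩ := P.exists_pow_mul_mem hF ht (bE.repr z j)
    refine ⟨n, b j ⊗ₜ ⟨_, hn⟩, ?_⟩
    rw [Place.tensorMap_tmul, hb, Algebra.smul_def, map_mul, map_pow]
    ring

variable [Finite k] [FiniteDimensional k k']

/-- The `q ^ N`-th power map is the identity on `(k' ⊗ O_P) / (t) = k' ⊗ κ(P)` if both `k'` and
`κ(P)` embed into the extension of degree `N` of `k`. -/
theorem Place.exists_pow_sub_self_eq (hF : IsFunctionField k F) (P : Place k F)
    {t : P.toValuationSubring} (ht : Irreducible t) {N : ℕ} (hN : P.degree ∣ N)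
    (hN' : Module.finrank k k' ∣ N) (y : k' ⊗[k] P.toValuationSubring) :
    ∃ y', y ^ Nat.card k ^ N - y = (1 ⊗ₜ t) * y' := by
  have := Fintype.ofFinite k
  have hφ : ∃ φ : (k' ⊗[k] P.toValuationSubring) →+* (k' ⊗[k] P.toValuationSubring),
      ∀ y, φ y = y ^ Nat.card k ^ N := by
    clear hN hN'
    induction N with
    | zero => exact ⟨RingHom.id _, fun y => by simp⟩
    | succ N ih =>
      obtain ⟨φ, hφ⟩ := ih
      refine ⟨(FiniteField.frobeniusAlgHom k _).toRingHom.comp φ, fun y => ?_⟩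
      rw [RingHom.comp_apply, hφ, pow_succ, pow_mul, Nat.card_eq_fintype_card]
      simp
  obtain ⟨φ, hφ⟩ := hφ
  simp_rw [← hφ]
  induction y with
  | zero => exact ⟨0, by simp⟩
  | add x y hx hy =>
    obtain ⟨x', hx'⟩ := hx
    obtain ⟨y', hy'⟩ := hy
    exact ⟨x' + y', by rw [map_add, mul_add, ← hx', ← hy']; ring⟩
  | tmul x a =>
    obtain ⟨c, hc, hca⟩ := P.exists_eq_mul_of_mem_nonunits hF ht
      (P.pow_sub_self_mem_nonunits hF hN a.2)
    have hx : x ^ Nat.card k ^ N = x := by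
      have : Finite k' := Module.finite_of_finite k
      have := Fintype.ofFinite k'
      obtain ⟨m, rfl⟩ := hN'
      rw [pow_mul, ← Module.natCard_eq_pow_finrank, Nat.card_eq_fintype_card]
      exact FiniteField.pow_card_pow m x
    have ha : a ^ Nat.card k ^ N - a = t * ⟨c, hc⟩ := Subtype.ext hca
    refine ⟨x ⊗ₜ ⟨c, hc⟩, ?_⟩
    rw [hφ, Algebra.TensorProduct.tmul_pow, hx, ← tmul_sub, ha,
      Algebra.TensorProduct.tmul_mul_tmul, one_mul]

theorem Place.exists_exponent_pow_sub_self_eq (hF : IsFunctionField k F) (P : Place k F)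
    {t : P.toValuationSubring} (ht : Irreducible t) : ∃ M : ℕ, 1 < M ∧
    ∀ y : k' ⊗[k] P.toValuationSubring, ∃ y', y ^ M - y = (1 ⊗ₜ t) * y' :=
  ⟨Nat.card k ^ (P.degree * Module.finrank k k'),
    Nat.one_lt_pow (Nat.mul_pos (P.degree_pos hF) Module.finrank_pos).ne' Finite.one_lt_card,
    P.exists_pow_sub_self_eq hF ht (dvd_mul_right _ _) (dvd_mul_left _ _)⟩

end Extension

/-! ### Local rings and residue fields above a place -/

section Extension

variable {k k' F E : Type*} [Field k] [Field k'] [Field F] [Field E] [Algebra k k'] [Algebra k F]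
  [Algebra k E] [Algebra k' E] [Algebra F E] [IsScalarTower k k' E] [IsScalarTower k F E]
  [Algebra.IsIntegral F E]

/-- The map `k' ⊗ O_P → κ(Q)` for a place `Q` above `P`. -/
noncomputable def Place.tensorResidue {P : Place k F} {Q : Place k' E} (h : Q.restrict k F = P) :
    k' ⊗[k] P.toValuationSubring →ₐ[k'] IsLocalRing.ResidueField Q.toValuationSubring :=
  (IsScalarTower.toAlgHom k' Q.toValuationSubring _).comp
    { (P.tensorMap k' E).toRingHom.codRestrict Q.toValuationSubring (Place.tensorMap_mem h) with
      commutes' := fun x => Subtype.ext ((P.tensorMap k' E).commutes x) }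

theorem Place.tensorResidue_apply {P : Place k F} {Q : Place k' E} (h : Q.restrict k F = P)
    (y : k' ⊗[k] P.toValuationSubring) : Place.tensorResidue h y =
      IsLocalRing.residue _ ⟨P.tensorMap k' E y, Place.tensorMap_mem h y⟩ :=
  rfl

theorem Place.algebraMap_mem_of_restrict_eq {P : Place k F} {Q : Place k' E}
    (h : Q.restrict k F = P) (a : P.toValuationSubring) :
    algebraMap F E a ∈ Q.toValuationSubring := by
  subst h
  exact Place.mem_restrict.1 a.2

theorem Place.tensorResidue_one_tmul {P : Place k F} {Q : Place k' E} (h : Q.restrict k F = P)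
    (a : P.toValuationSubring) : Place.tensorResidue h (1 ⊗ₜ a) =
      IsLocalRing.residue _ ⟨algebraMap F E a, Place.algebraMap_mem_of_restrict_eq h a⟩ := by
  rw [Place.tensorResidue_apply]
  refine congrArg _ (Subtype.ext ?_)
  change P.tensorMap k' E (1 ⊗ₜ a) = algebraMap F E a
  rw [Place.tensorMap_tmul, map_one, one_mul]

theorem Place.tensorResidue_eq_zero_iff {P : Place k F} {Q : Place k' E}
    (h : Q.restrict k F = P) {y : k' ⊗[k] P.toValuationSubring} :
    Place.tensorResidue h y = 0 ↔ P.tensorMap k' E y ∈ Q.toValuationSubring.nonunits := by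
  rw [Place.tensorResidue_apply, IsLocalRing.residue_eq_zero_iff,
    ← ValuationSubring.coe_mem_nonunits_iff]

theorem Place.algebraMap_mem_nonunits {P : Place k F} {Q : Place k' E} (h : Q.restrict k F = P)
    {t : P.toValuationSubring} (ht : Irreducible t) :
    algebraMap F E t ∈ Q.toValuationSubring.nonunits := by
  subst h
  exact Place.mem_nonunits_restrict.1 (Place.coe_mem_nonunits_of_irreducible _ ht)

theorem Place.valuation_tensorMap_eq_one {P : Place k F} {Q : Place k' E}
    (h : Q.restrict k F = P) {c : k' ⊗[k] P.toValuationSubring}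
    (hc : Place.tensorResidue h c ≠ 0) : Q.toValuationSubring.valuation (P.tensorMap k' E c) = 1 :=
  ((Q.toValuationSubring.valuation_le_one_iff _).2 (Place.tensorMap_mem h c)).antisymm
    (not_lt.1 fun hlt => hc ((Place.tensorResidue_eq_zero_iff h).2 hlt))

theorem Place.mem_of_mul_eq_tensorMap {P : Place k F} {Q : Place k' E} (h : Q.restrict k F = P)
    {c y : k' ⊗[k] P.toValuationSubring} (hc : Place.tensorResidue h c ≠ 0) {z : E}
    (hz : P.tensorMap k' E c * z = P.tensorMap k' E y) : z ∈ Q.toValuationSubring := by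
  have h1 := (Q.toValuationSubring.valuation_le_one_iff _).2 (Place.tensorMap_mem h y)
  rwa [← hz, map_mul, Place.valuation_tensorMap_eq_one h hc, one_mul,
    ValuationSubring.valuation_le_one_iff] at h1

variable [Finite k] [FiniteDimensional k k']

/-- If `y ∈ k' ⊗ O_P` lies in the maximal ideal of `Q`, then `y` is divisible by `t` up to a factor
`c` that is a unit at `Q`. With `y ^ M ≡ y` modulo `t`, one can take `c = 1 - y ^ (M - 1)`. -/
theorem Place.exists_unit_mul_eq (hF : IsFunctionField k F) {P : Place k F} {Q : Place k' E}
    (h : Q.restrict k F = P) {t : P.toValuationSubring} (ht : Irreducible t)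
    {y : k' ⊗[k] P.toValuationSubring}
    (hy : P.tensorMap k' E y ∈ Q.toValuationSubring.nonunits) :
    ∃ c y', Place.tensorResidue h c ≠ 0 ∧ c * y = (1 ⊗ₜ t) * y' := by
  obtain ⟨M, hM, hpow⟩ := P.exists_exponent_pow_sub_self_eq (k' := k') hF ht
  obtain ⟨y', hy'⟩ := hpow y
  refine ⟨1 - y ^ (M - 1), -y', ?_, ?_⟩
  · rw [map_sub, map_pow, (Place.tensorResidue_eq_zero_iff h).2 hy, map_one,
      zero_pow (by omega), sub_zero]
    exact one_ne_zero
  · rw [mul_neg, ← hy', sub_mul, one_mul, ← pow_succ, Nat.sub_add_cancel hM.le, neg_sub]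

/-- `O_Q` is the localization of `k' ⊗ O_P` at the centre of `Q`. -/
theorem Place.exists_unit_mul_eq_tensorMap (hF : IsFunctionField k F) {ι : Type*} [Fintype ι]
    {b : Module.Basis ι k k'} {bE : Module.Basis ι F E}
    (hb : ∀ j, bE j = algebraMap k' E (b j)) {P : Place k F} {Q : Place k' E}
    (h : Q.restrict k F = P) {z : E} (hz : z ∈ Q.toValuationSubring) :
    ∃ c y, Place.tensorResidue h c ≠ 0 ∧ P.tensorMap k' E c * z = P.tensorMap k' E y := by
  obtain ⟨t, ht⟩ := P.exists_irreducible hF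
  have ht0 : algebraMap F E t ≠ 0 := by
    simpa using fun h => ht.ne_zero (Subtype.ext h)
  obtain ⟨n, y, hn⟩ := P.exists_pow_mul_eq_tensorMap hF hb ht z
  induction n generalizing z y with
  | zero => exact ⟨1, y, by simp, by simpa using hn⟩
  | succ n ih =>
    have hy : P.tensorMap k' E y ∈ Q.toValuationSubring.nonunits := by
      rw [← hn, pow_succ', mul_assoc, ValuationSubring.mem_nonunits_iff, map_mul]
      refine mul_lt_one_of_nonneg_of_lt_one_left zero_le (Place.algebraMap_mem_nonunits h ht)
        ((Q.toValuationSubring.valuation_le_one_iff _).2 (Q.toValuationSubring.mul_mem _ _ ?_ hz))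
      exact pow_mem (Q.toValuationSubring.nonunits_subset (Place.algebraMap_mem_nonunits h ht)) n
    obtain ⟨c, y', hc, hcy⟩ := Place.exists_unit_mul_eq hF h ht hy
    obtain ⟨c', y'', hc', hcy'⟩ := ih
      (Q.toValuationSubring.mul_mem _ _ (Place.tensorMap_mem h c) hz) y' (by
        have := congrArg (P.tensorMap k' E) hcy
        rw [map_mul, map_mul, Place.tensorMap_tmul, map_one, one_mul, ← hn, pow_succ'] at this
        refine mul_left_cancel₀ ht0 ?_
        rw [← this]
        ring)
    exact ⟨c' * c, y'', by rw [map_mul]; exact mul_ne_zero hc' hc,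
      by rw [map_mul, mul_assoc, hcy']⟩

/-- Constant field extensions are unramified: a uniformizer at `P` is a uniformizer at every place
above `P`. -/
theorem Place.exists_irreducible_eq_algebraMap (hF : IsFunctionField k F)
    (hE : IsConstantFieldExtension k k' F E) {P : Place k F} {Q : Place k' E}
    (h : Q.restrict k F = P) {t : P.toValuationSubring} (ht : Irreducible t) :
    ∃ s : Q.toValuationSubring, Irreducible s ∧ (s : E) = algebraMap F E t := by
  obtain ⟨b, bE, hb⟩ := hE.exists_basis hF.algebraicClosure_eq_bot
  have := Q.isDiscreteValuationRing (hE.isFunctionField hF)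
  have htQ := Place.algebraMap_mem_nonunits h ht
  have ht0 : algebraMap F E t ≠ 0 := by
    simpa using fun h => ht.ne_zero (Subtype.ext h)
  refine ⟨⟨_, Q.toValuationSubring.nonunits_subset htQ⟩, ?_, rfl⟩
  rw [IsDiscreteValuationRing.irreducible_iff_uniformizer]
  refine le_antisymm (fun z hz => ?_) ((Ideal.span_singleton_le_iff_mem _).2
    (Q.toValuationSubring.coe_mem_nonunits_iff.1 htQ))
  rw [← ValuationSubring.coe_mem_nonunits_iff] at hz
  obtain ⟨c, y, hc, hcy⟩ := Place.exists_unit_mul_eq_tensorMap hF hb h z.2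
  have hy : P.tensorMap k' E y ∈ Q.toValuationSubring.nonunits := by
    rw [ValuationSubring.mem_nonunits_iff, ← hcy, map_mul,
      Place.valuation_tensorMap_eq_one h hc, one_mul]
    exact hz
  obtain ⟨c', y', hc', hcy'⟩ := Place.exists_unit_mul_eq hF h ht hy
  have hw : (algebraMap F E t)⁻¹ * z ∈ Q.toValuationSubring := by
    refine Place.mem_of_mul_eq_tensorMap h (c := c' * c) (y := y')
      (by rw [map_mul]; exact mul_ne_zero hc' hc) (mul_left_cancel₀ ht0 ?_)
    have := congrArg (P.tensorMap k' E) hcy'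
    rw [map_mul, map_mul, Place.tensorMap_tmul, map_one, one_mul, ← hcy] at this
    rw [← this, map_mul]
    field_simp
  refine Ideal.mem_span_singleton.2 ⟨⟨_, hw⟩, Subtype.ext ?_⟩
  exact (mul_inv_cancel_left₀ ht0 _).symm

theorem Place.finite_residueField (hF : IsFunctionField k F) (P : Place k F) :
    Finite (IsLocalRing.ResidueField P.toValuationSubring) :=
  have := P.finiteDimensional_residueField hF
  Module.finite_of_finite k

/-- `κ(Q)` is generated by `k'` and `κ(P)`. -/
theorem Place.tensorResidue_surjective (hF : IsFunctionField k F)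
    (hE : IsConstantFieldExtension k k' F E) {P : Place k F} {Q : Place k' E}
    (h : Q.restrict k F = P) : Function.Surjective (Place.tensorResidue h) := by
  obtain ⟨b, bE, hb⟩ := hE.exists_basis hF.algebraicClosure_eq_bot
  intro x
  obtain ⟨z, rfl⟩ := IsLocalRing.residue_surjective x
  obtain ⟨c, y, hc, hcy⟩ := Place.exists_unit_mul_eq_tensorMap hF hb h z.2
  have : Finite k' := Module.finite_of_finite k
  have := Q.finite_residueField (hE.isFunctionField hF)
  have := Fintype.ofFinite (IsLocalRing.ResidueField Q.toValuationSubring)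
  have hcy' : Place.tensorResidue h c * IsLocalRing.residue _ z = Place.tensorResidue h y := by
    rw [Place.tensorResidue_apply, Place.tensorResidue_apply, ← map_mul]
    exact congrArg _ (Subtype.ext hcy)
  have hcard := Fintype.one_lt_card (α := IsLocalRing.ResidueField Q.toValuationSubring)
  -- the inverse of the residue of `c` is a power of it, as the residue field is finite
  refine ⟨c ^ (Fintype.card (IsLocalRing.ResidueField Q.toValuationSubring) - 2) * y, ?_⟩
  rw [map_mul, map_pow, ← hcy', ← mul_assoc, ← pow_succ,
    show Fintype.card (IsLocalRing.ResidueField Q.toValuationSubring) - 2 + 1 =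
      Fintype.card (IsLocalRing.ResidueField Q.toValuationSubring) - 1 by omega,
    FiniteField.pow_card_sub_one_eq_one _ hc, one_mul]

/-- `deg Q` divides `deg P` for `Q` above `P`. With `d = deg P`, every element of `κ(Q)` satisfies
`x ^ (q' ^ d) = x`, where `q'` is the number of elements of `k'`, so that the Frobenius of
`κ(Q) / k'`, whose order is `deg Q`, has trivial `d`-th power. -/
theorem Place.degree_dvd_degree_restrict (hF : IsFunctionField k F)
    (hE : IsConstantFieldExtension k k' F E) (Q : Place k' E) :
    Q.degree ∣ (Q.restrict k F).degree := by
  have : Finite k' := Module.finite_of_finite k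
  have := Q.finite_residueField (hE.isFunctionField hF)
  have := Fintype.ofFinite k'
  obtain ⟨t, ht⟩ := (Q.restrict k F).exists_irreducible hF
  rw [Place.degree, ← FiniteField.orderOf_frobeniusAlgEquivOfAlgebraic k'
    (IsLocalRing.ResidueField Q.toValuationSubring), orderOf_dvd_iff_pow_eq_one]
  ext x
  obtain ⟨y, rfl⟩ := Place.tensorResidue_surjective hF hE rfl x
  obtain ⟨y', hy'⟩ := (Q.restrict k F).exists_pow_sub_self_eq hF ht (k' := k')
    (dvd_mul_left _ (Module.finrank k k')) (dvd_mul_right _ _) y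
  have ht' : Place.tensorResidue (rfl : Q.restrict k F = _) (1 ⊗ₜ t) = 0 := by
    rw [Place.tensorResidue_eq_zero_iff, Place.tensorMap_tmul, map_one, one_mul]
    exact Place.algebraMap_mem_nonunits rfl ht
  have h0 := congrArg (Place.tensorResidue (rfl : Q.restrict k F = _)) hy'
  rw [map_mul, ht', zero_mul, map_sub, map_pow, sub_eq_zero, pow_mul,
    ← Module.natCard_eq_pow_finrank, Nat.card_eq_fintype_card] at h0
  rw [AlgEquiv.coe_pow, FiniteField.coe_frobeniusAlgEquivOfAlgebraic_iterate, AlgEquiv.one_apply]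
  exact h0

end Extension

/-! ### Points with values in a finite field -/

section Extension

variable {k k' F E : Type*} [Field k] [Field k'] [Field F] [Field E] [Algebra k k'] [Algebra k F]
  [Algebra k E] [Algebra k' E] [Algebra F E] [IsScalarTower k k' E] [IsScalarTower k F E]
  [Algebra.IsIntegral F E]

/-- A proper ideal `I` of `k' ⊗ O_P` containing the uniformizer `t` is contained in the centre of
some place above `P`. -/
theorem Place.exists_restrict_eq (hF : IsFunctionField k F) (P : Place k F)
    {t : P.toValuationSubring} (ht : Irreducible t)
    (hinj : Function.Injective (P.tensorMap k' E))
    {I : Ideal (k' ⊗[k] P.toValuationSubring)} (hI : I ≠ ⊤) (htI : 1 ⊗ₜ t ∈ I) :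
    ∃ Q : Place k' E, Q.restrict k F = P ∧
      ∀ y ∈ I, P.tensorMap k' E y ∈ Q.toValuationSubring.nonunits := by
  obtain ⟨V, hV, hVI⟩ := exists_valuationSubring_of_injective
    (f := (P.tensorMap k' E).toRingHom) hinj hI
  have ht0 : algebraMap F E t ≠ 0 := by
    simpa using fun h => ht.ne_zero (Subtype.ext h)
  let Q : Place k' E := ⟨V, fun x => by simpa using hV (x ⊗ₜ 1), fun h => by
    have h1 := hVI _ htI
    rcases V.mem_nonunits_iff_or.1 h1 with h1 | h1
    · exact ht0 (by simpa using h1)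
    · exact h1 (h ▸ ValuationSubring.mem_top _)⟩
  refine ⟨Q, (Place.ext (P.eq_of_le hF (fun a ha => ?_) (Q.restrict k F).ne_top)).symm, hVI⟩
  have := hV (1 ⊗ₜ ⟨a, ha⟩)
  rw [Place.mem_restrict]
  simpa using this

section Points

variable {L : Type*} [Field L] [Algebra k L] [Algebra k' L] [IsScalarTower k k' L]

variable (k F) in
/-- The `L`-valued point of `F / k` below an `L`-valued point of `E / k'`. -/
noncomputable def Place.restrictPoint (Q : Place k' E)
    (φ : IsLocalRing.ResidueField Q.toValuationSubring →ₐ[k'] L) :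
    IsLocalRing.ResidueField (Q.restrict k F).toValuationSubring →ₐ[k] L :=
  Ideal.Quotient.liftₐ (IsLocalRing.maximalIdeal (Q.restrict k F).toValuationSubring)
    { (φ : _ →+* L).comp ((IsLocalRing.residue Q.toValuationSubring).comp
        (((algebraMap F E).comp (Q.restrict k F).toValuationSubring.subtype).codRestrict
          Q.toValuationSubring fun a => a.2)) with
      commutes' := fun c => by
        have h : (⟨algebraMap F E (algebraMap k F c), Q.mem_restrict.1
            ((Q.restrict k F).algebraMap_mem c)⟩ : Q.toValuationSubring) =
              algebraMap k' Q.toValuationSubring (algebraMap k k' c) := Subtype.ext (by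
          change algebraMap F E (algebraMap k F c) = algebraMap k' E (algebraMap k k' c)
          rw [← IsScalarTower.algebraMap_apply k F E, ← IsScalarTower.algebraMap_apply k k' E])
        change φ (IsLocalRing.residue _ ⟨algebraMap F E (algebraMap k F c), _⟩) = _
        rw [h, IsScalarTower.algebraMap_apply k k' L]
        exact φ.commutes _ }
    fun a ha => by
      change φ (IsLocalRing.residue _ ⟨algebraMap F E a, a.2⟩) = 0
      rw [(IsLocalRing.residue_eq_zero_iff _).2 (ValuationSubring.coe_mem_nonunits_iff.1
        (Place.mem_nonunits_restrict.1 (ValuationSubring.coe_mem_nonunits_iff.2 ha))), map_zero]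

variable [Finite k] [FiniteDimensional k k']

/-- The `L`-valued points of `E / k'` are the `L`-valued points of `F / k`. A `k`-embedding
`κ(P) → L` extends uniquely to a `k'`-homomorphism `k' ⊗ O_P → L`, and the kernel of the latter is
the centre of exactly one place above `P`. -/
theorem bijective_restrictPoint (hF : IsFunctionField k F)
    (hE : IsConstantFieldExtension k k' F E) [Finite L] : Function.Bijective
    (fun x : Σ Q : Place k' E, IsLocalRing.ResidueField Q.toValuationSubring →ₐ[k'] L =>
      (⟨x.1.restrict k F, x.1.restrictPoint k F x.2⟩ :
        Σ P : Place k F, IsLocalRing.ResidueField P.toValuationSubring →ₐ[k] L)) := by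
  have hFE := hE.isFunctionField hF
  obtain ⟨b, bE, hb⟩ := hE.exists_basis hF.algebraicClosure_eq_bot
  constructor
  · rintro ⟨Q, φ⟩ ⟨Q', φ'⟩ hQQ'
    have hsig : ∀ x y : Σ P : Place k F,
        IsLocalRing.ResidueField P.toValuationSubring →ₐ[k] L, x = y →
        ∀ (a : F) (hx : a ∈ x.1.toValuationSubring) (hy : a ∈ y.1.toValuationSubring),
          x.2 (IsLocalRing.residue _ ⟨a, hx⟩) = y.2 (IsLocalRing.residue _ ⟨a, hy⟩) := by
      rintro x _ rfl a _ _
      rfl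
    have h' : Q'.restrict k F = Q.restrict k F := (congrArg Sigma.fst hQQ').symm
    have hcomp : φ.comp (Place.tensorResidue (rfl : Q.restrict k F = _)) =
        φ'.comp (Place.tensorResidue h') := by
      refine Algebra.TensorProduct.ext (by ext) (AlgHom.ext fun a => ?_)
      have h1 := hsig _ _ hQQ' a a.2 (by dsimp only; rw [h']; exact a.2)
      change φ (Place.tensorResidue rfl (1 ⊗ₜ a)) = φ' (Place.tensorResidue h' (1 ⊗ₜ a))
      rw [Place.tensorResidue_one_tmul, Place.tensorResidue_one_tmul]
      exact h1
    have hle : Q.toValuationSubring ≤ Q'.toValuationSubring := by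
      intro z hz
      obtain ⟨c, y, hc, hcy⟩ := Place.exists_unit_mul_eq_tensorMap hF hb
        (rfl : Q.restrict k F = _) hz
      refine Place.mem_of_mul_eq_tensorMap h' (fun h0 => hc ?_) hcy
      have := congrArg (fun f => f c) hcomp
      simp only [AlgHom.comp_apply, h0, map_zero] at this
      exact (map_eq_zero φ).1 this
    obtain rfl := Place.ext (Q.eq_of_le hFE hle Q'.ne_top)
    congr 1
    refine AlgHom.ext fun x => ?_
    obtain ⟨y, rfl⟩ := Place.tensorResidue_surjective hF hE (rfl : Q.restrict k F = _) x
    exact congrArg (fun f => f y) hcomp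
  · rintro ⟨P, ψ⟩
    obtain ⟨t, ht⟩ := P.exists_irreducible hF
    let f : k' ⊗[k] P.toValuationSubring →ₐ[k'] L :=
      Algebra.TensorProduct.lift (Algebra.ofId k' L)
        (ψ.comp (IsScalarTower.toAlgHom k P.toValuationSubring _)) fun _ _ => Commute.all _ _
    have hf : ∀ a, f (1 ⊗ₜ a) = ψ (IsLocalRing.residue _ a) := fun a => by
      rw [Algebra.TensorProduct.lift_tmul, map_one, one_mul]
      rfl
    obtain ⟨Q, rfl, hQ⟩ := P.exists_restrict_eq hF ht (P.tensorMap_injective hb)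
      (I := RingHom.ker f) (RingHom.ker_ne_top f) (by
        rw [RingHom.mem_ker, hf, (IsLocalRing.residue_eq_zero_iff t).2 ht.1, map_zero])
    have hker : RingHom.ker (Place.tensorResidue (rfl : Q.restrict k F = _)).toRingHom ≤
        RingHom.ker f.toRingHom := by
      intro y hy
      have hy0 : Place.tensorResidue (rfl : Q.restrict k F = _) y = 0 := hy
      by_contra hfy
      have hfy' : f y ≠ 0 := hfy
      -- a power of `y` has value `1` in the finite field `L`, while `y` is in the centre of `Q`
      have := Fintype.ofFinite L
      have h1 : y ^ (Fintype.card L - 1) - 1 ∈ RingHom.ker f := by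
        rw [RingHom.mem_ker, map_sub, map_pow, FiniteField.pow_card_sub_one_eq_one _ hfy', map_one,
          sub_self]
      have h2 := (Place.tensorResidue_eq_zero_iff rfl).2 (hQ _ h1)
      have hcard := Fintype.one_lt_card (α := L)
      rw [map_sub, map_pow, hy0, zero_pow (by omega), map_one, zero_sub] at h2
      exact one_ne_zero (neg_eq_zero.1 h2)
    have hsurj := Place.tensorResidue_surjective hF hE (rfl : Q.restrict k F = _)
    refine ⟨⟨Q, AlgHom.liftOfSurjective _ hsurj f hker⟩, ?_⟩
    refine Sigma.ext rfl (heq_of_eq (AlgHom.ext fun x => ?_))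
    obtain ⟨a, rfl⟩ := IsLocalRing.residue_surjective x
    rw [← hf, ← AlgHom.liftOfSurjective_apply _ hsurj f hker (1 ⊗ₜ a)]
    rw [Place.tensorResidue_one_tmul]
    rfl

end Points

end Extension

/-! ### Integral elements and the fundamental identity -/

section Extension

variable {k k' F E : Type*} [Field k] [Field k'] [Field F] [Field E] [Algebra k k'] [Algebra k F]
  [Algebra k E] [Algebra k' E] [Algebra F E] [IsScalarTower k k' E] [IsScalarTower k F E]
  [Algebra.IsIntegral F E] [Finite k] [FiniteDimensional k k']

/-- The image of `k' ⊗ O_P` in `E` is the intersection of the valuation rings above `O_P`. -/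
theorem Place.exists_eq_tensorMap (hF : IsFunctionField k F) {ι : Type*} [Fintype ι]
    {b : Module.Basis ι k k'} {bE : Module.Basis ι F E}
    (hb : ∀ j, bE j = algebraMap k' E (b j)) {P : Place k F} {z : E}
    (hz : ∀ Q : Place k' E, Q.restrict k F = P → z ∈ Q.toValuationSubring) :
    ∃ y, z = P.tensorMap k' E y := by
  obtain ⟨t, ht⟩ := P.exists_irreducible hF
  have ht0 : algebraMap F E t ≠ 0 := by
    simpa using fun h => ht.ne_zero (Subtype.ext h)
  obtain ⟨M, hM, hpow⟩ := P.exists_exponent_pow_sub_self_eq (k' := k') hF ht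
  obtain ⟨n, y, hn⟩ := P.exists_pow_mul_eq_tensorMap hF hb ht z
  induction n generalizing y with
  | zero => exact ⟨y, by simpa using hn⟩
  | succ n ih =>
    suffices h : ∃ y', y = (1 ⊗ₜ t) * y' by
      obtain ⟨y', rfl⟩ := h
      refine ih y' (mul_left_cancel₀ ht0 ?_)
      rw [map_mul, Place.tensorMap_tmul, map_one, one_mul, pow_succ', mul_assoc] at hn
      exact hn
    by_contra hy
    obtain ⟨y', hy'⟩ := hpow y
    -- otherwise `y ^ (M - 1)` is an idempotent modulo `t`, and `t` and `1 - y ^ (M - 1)` have a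
    -- common zero `Q`, at which `y` is a unit
    have hI : Ideal.span {(1 : k') ⊗ₜ[k] t, 1 - y ^ (M - 1)} ≠ ⊤ := by
      rw [Ne, Ideal.eq_top_iff_one, Ideal.mem_span_pair]
      rintro ⟨a, c, hac⟩
      refine hy ⟨a * y - c * y', ?_⟩
      have h1 : y ^ (M - 1) * y = y + (1 ⊗ₜ t) * y' := by
        rw [← hy', ← pow_succ, Nat.sub_add_cancel hM.le]
        ring
      linear_combination (-y) * hac - c * h1
    obtain ⟨Q, hQ, hQI⟩ := P.exists_restrict_eq hF ht (P.tensorMap_injective hb) hI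
      (Ideal.subset_span (by simp))
    have h1 := (Place.tensorResidue_eq_zero_iff hQ).2
      (hQI (1 - y ^ (M - 1)) (Ideal.subset_span (by simp)))
    have h2 : Place.tensorResidue hQ y = 0 := by
      rw [Place.tensorResidue_eq_zero_iff, ← hn, ValuationSubring.mem_nonunits_iff, pow_succ',
        mul_assoc, map_mul]
      refine mul_lt_one_of_nonneg_of_lt_one_left zero_le (Place.algebraMap_mem_nonunits hQ ht)
        ((Q.toValuationSubring.valuation_le_one_iff _).2
          (Q.toValuationSubring.mul_mem _ _ ?_ (hz Q hQ)))
      exact pow_mem (Place.algebraMap_mem_of_restrict_eq hQ t) n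
    rw [map_sub, map_pow, h2, zero_pow (by omega), map_one, sub_zero] at h1
    exact one_ne_zero h1

/-- The integral elements above `O_P` are those whose coordinates with respect to a basis of `k' / k`
lie in `O_P`. -/
theorem Place.forall_mem_iff (hF : IsFunctionField k F) {ι : Type*} [Fintype ι]
    {b : Module.Basis ι k k'} {bE : Module.Basis ι F E}
    (hb : ∀ j, bE j = algebraMap k' E (b j)) {P : Place k F} {z : E} :
    (∀ Q : Place k' E, Q.restrict k F = P → z ∈ Q.toValuationSubring) ↔
      ∀ j, bE.repr z j ∈ P.toValuationSubring := by
  refine ⟨fun hz j => ?_, fun hz Q hQ => ?_⟩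
  · obtain ⟨y, rfl⟩ := Place.exists_eq_tensorMap hF hb hz
    obtain ⟨a, -, ha⟩ := P.tensorMap_eq_sum (E := E) b y
    simp_rw [ha, ← hb]
    rw [bE.repr_sum_self]
    exact (a j).2
  · rw [← bE.sum_repr z]
    refine sum_mem fun j _ => ?_
    rw [hb, Algebra.smul_def]
    exact Q.toValuationSubring.mul_mem _ _ (Place.algebraMap_mem_of_restrict_eq hQ ⟨_, hz j⟩)
      (Q.algebraMap_mem _)

/-- A finite field has extensions of every positive degree. -/
theorem exists_finrank_eq (K : Type*) [Field K] [Finite K] {n : ℕ} (hn : n ≠ 0) :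
    ∃ (L : Type) (_ : Field L) (_ : Algebra K L), Module.finrank K L = n := by
  obtain ⟨p, hp⟩ := CharP.exists K
  have : Fact p.Prime := ⟨CharP.char_is_prime K p⟩
  have : NeZero n := ⟨hn⟩
  exact ⟨FiniteField.Extension K p n, inferInstance, inferInstance,
    FiniteField.finrank_extension K p n⟩

theorem Place.finite_fiber (hF : IsFunctionField k F) (hE : IsConstantFieldExtension k k' F E)
    (P : Place k F) : {Q : Place k' E | Q.restrict k F = P}.Finite := by
  have : Finite k' := Module.finite_of_finite k
  refine (Place.finite_setOf_degree_dvd (hE.isFunctionField hF)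
    (P.degree_pos hF).ne').subset ?_
  rintro Q rfl
  exact Q.degree_dvd_degree_restrict hF hE

/-- The degrees of the places above `P` add up to the degree of `P`: both are the number of points
above `P` with values in the extension of `k'` of degree `deg P`. -/
theorem Place.sum_degree_fiber (hF : IsFunctionField k F) (hE : IsConstantFieldExtension k k' F E)
    (P : Place k F) : ∑ Q ∈ (Place.finite_fiber hF hE P).toFinset, Q.degree = P.degree := by
  have : Finite k' := Module.finite_of_finite k
  have hFE := hE.isFunctionField hF
  obtain ⟨L, _, _, hL⟩ := exists_finrank_eq k' (P.degree_pos hF).ne'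
  let _ : Algebra k L := Algebra.compHom L (algebraMap k k')
  have : IsScalarTower k k' L := IsScalarTower.of_algebraMap_eq fun _ => rfl
  have : FiniteDimensional k' L :=
    Module.finite_of_finrank_pos (hL ▸ P.degree_pos hF)
  have : Finite L := Module.finite_of_finite k'
  have hkL := Module.finrank_mul_finrank k k' L
  have hcard : ∀ Q : (Place.finite_fiber hF hE P).toFinset,
      Nat.card (IsLocalRing.ResidueField Q.1.toValuationSubring →ₐ[k'] L) = Q.1.degree := by
    rintro ⟨Q, hQ⟩
    obtain rfl := (Place.finite_fiber hF hE P).mem_toFinset.1 hQ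
    exact FiniteField.natCard_algHom_of_finrank_dvd
      (hL.symm ▸ Q.degree_dvd_degree_restrict hF hE)
  have hfin : ∀ Q : (Place.finite_fiber hF hE P).toFinset,
      Finite (IsLocalRing.ResidueField Q.1.toValuationSubring →ₐ[k'] L) := fun Q =>
    Nat.finite_of_card_ne_zero (by rw [hcard Q]; exact (Q.1.degree_pos hFE).ne')
  have hcardP : Nat.card (IsLocalRing.ResidueField P.toValuationSubring →ₐ[k] L) = P.degree :=
    FiniteField.natCard_algHom_of_finrank_dvd (by
      rw [← hkL, hL]
      exact dvd_mul_left _ _)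
  rw [← Finset.sum_coe_sort _ fun Q : Place k' E => Q.degree,
    ← Finset.sum_congr rfl fun Q _ => hcard Q, ← Nat.card_sigma, ← hcardP]
  let f := fun x : Σ Q : Place k' E, IsLocalRing.ResidueField Q.toValuationSubring →ₐ[k'] L =>
      (⟨x.1.restrict k F, x.1.restrictPoint k F x.2⟩ :
        Σ P : Place k F, IsLocalRing.ResidueField P.toValuationSubring →ₐ[k] L)
  have hf : Function.Bijective f := bijective_restrictPoint hF hE
  let e₁ : (Σ Q : (Place.finite_fiber hF hE P).toFinset,
      IsLocalRing.ResidueField Q.1.toValuationSubring →ₐ[k'] L) ≃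
      {x : Σ Q : Place k' E, IsLocalRing.ResidueField Q.toValuationSubring →ₐ[k'] L //
        (f x).1 = P} :=
    { toFun := fun x => ⟨⟨x.1.1, x.2⟩, (Place.finite_fiber hF hE P).mem_toFinset.1 x.1.2⟩
      invFun := fun x => ⟨⟨x.1.1, (Place.finite_fiber hF hE P).mem_toFinset.2 x.2⟩, x.1.2⟩
      left_inv := fun _ => rfl
      right_inv := fun _ => rfl }
  let e₂ : {x : Σ P : Place k F, IsLocalRing.ResidueField P.toValuationSubring →ₐ[k] L //
      x.1 = P} ≃ (IsLocalRing.ResidueField P.toValuationSubring →ₐ[k] L) :=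
    (Equiv.subtypeSigmaEquiv _ (· = P)).trans (Equiv.uniqueSigma fun Q : {Q // Q = P} =>
      (IsLocalRing.ResidueField Q.1.toValuationSubring →ₐ[k] L))
  exact Nat.card_congr ((e₁.trans ((Equiv.ofBijective f hf).subtypeEquiv fun _ => Iff.rfl)).trans e₂)

end Extension

/-! ### Conorms, the genus and numbers of places -/

section Extension

variable {k k' F E : Type*} [Field k] [Field k'] [Field F] [Field E] [Algebra k k'] [Algebra k F]
  [Algebra k E] [Algebra k' E] [Algebra F E] [IsScalarTower k k' E] [IsScalarTower k F E]
  [Algebra.IsIntegral F E] [Finite k] [FiniteDimensional k k']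

/-- Existence of the conorm of a divisor. As the extension is unramified, its coefficient at `Q` is
the coefficient of the divisor at the place below `Q`. -/
theorem Divisor.exists_conorm (hF : IsFunctionField k F) (hE : IsConstantFieldExtension k k' F E)
    (A : Divisor k F) : ∃ C : Divisor k' E, ∀ Q, C Q = A (Q.restrict k F) := by
  refine ⟨Finsupp.ofSupportFinite (fun Q => A (Q.restrict k F)) ?_, fun Q => rfl⟩
  refine (A.support.finite_toSet.biUnion fun P _ => Place.finite_fiber hF hE P).subset
    fun Q hQ => Set.mem_biUnion (x := Q.restrict k F) ?_ rfl
  simpa using hQ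

theorem Divisor.degree_eq_of_conorm (hF : IsFunctionField k F)
    (hE : IsConstantFieldExtension k k' F E) {A : Divisor k F} {C : Divisor k' E}
    (hC : ∀ Q, C Q = A (Q.restrict k F)) : C.degree = A.degree := by
  classical
  rw [Divisor.degree, Finsupp.sum, ← Finset.sum_fiberwise_of_maps_to (t := A.support)
    (g := fun Q => Q.restrict k F) fun Q hQ => by simpa [← hC] using hQ, Divisor.degree,
    Finsupp.sum]
  refine Finset.sum_congr rfl fun P hP => ?_
  rw [← Place.sum_degree_fiber hF hE P, Nat.cast_sum, Finset.mul_sum]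
  refine Finset.sum_congr ?_ fun Q hQ => ?_
  · ext Q
    simp only [Finset.mem_filter, Finsupp.mem_support_iff, Set.Finite.mem_toFinset,
      Set.mem_ofPred_eq, and_iff_right_iff_imp, hC]
    rintro rfl
    exact Finsupp.mem_support_iff.1 hP
  · rw [hC, (Place.finite_fiber hF hE P).mem_toFinset.1 hQ]

/-- `L(Con A)` consists of the elements of `E` whose coordinates with respect to a basis of `k' / k`
lie in `L(A)`. -/
theorem mem_riemannRochSpace_conorm_iff (hF : IsFunctionField k F)
    (hE : IsConstantFieldExtension k k' F E) {ι : Type*} [Fintype ι]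
    {b : Module.Basis ι k k'} {bE : Module.Basis ι F E}
    (hb : ∀ j, bE j = algebraMap k' E (b j)) {A : Divisor k F} {C : Divisor k' E}
    (hC : ∀ Q, C Q = A (Q.restrict k F)) {z : E} :
    z ∈ riemannRochSpace C ↔ ∀ j, bE.repr z j ∈ riemannRochSpace A := by
  choose t ht using fun P : Place k F => P.exists_irreducible hF
  choose s hs hst using fun Q : Place k' E =>
    Place.exists_irreducible_eq_algebraMap hF hE (rfl : Q.restrict k F = _) (ht _)
  have h1 : z ∈ riemannRochSpace C ↔ ∀ P : Place k F, ∀ Q : Place k' E, Q.restrict k F = P →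
      ((t P : F) ^ A P) • z ∈ Q.toValuationSubring := by
    rw [mem_riemannRochSpace_iff_of_irreducible (hE.isFunctionField hF) hs]
    constructor
    · rintro h _ Q rfl
      rw [Algebra.smul_def, mul_comm, map_zpow₀, ← hst, ← hC]
      exact h Q
    · intro h Q
      have := h _ Q rfl
      rwa [Algebra.smul_def, mul_comm, map_zpow₀, ← hst, ← hC] at this
  rw [h1, forall_congr' fun P => Place.forall_mem_iff hF hb, forall_comm]
  refine forall_congr' fun j => ?_
  rw [mem_riemannRochSpace_iff_of_irreducible hF ht]
  refine forall_congr' fun P => ?_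
  rw [map_smul, Finsupp.smul_apply, smul_eq_mul, mul_comm]

/-- Taking coordinates identifies `L(Con A)` with `[k' : k]` copies of `L(A)` over `k`. -/
theorem finrank_riemannRochSpace_conorm (hF : IsFunctionField k F)
    (hE : IsConstantFieldExtension k k' F E) {A : Divisor k F} {C : Divisor k' E}
    (hC : ∀ Q, C Q = A (Q.restrict k F)) :
    Module.finrank k' (riemannRochSpace C) = Module.finrank k (riemannRochSpace A) := by
  obtain ⟨b, bE, hb⟩ := hE.exists_basis hF.algebraicClosure_eq_bot
  have hmem := fun z => mem_riemannRochSpace_conorm_iff hF hE hb hC (z := z)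
  have hsmul : ∀ (c : k) (z : E), bE.equivFun (c • z) = c • bE.equivFun z := fun c z => by
    rw [← algebraMap_smul F c z, map_smul]
    ext j
    simp [Algebra.smul_def]
  let e : riemannRochSpace C ≃ₗ[k] (Fin (Module.finrank k k') → riemannRochSpace A) :=
    { toFun := fun z j => ⟨bE.repr z j, (hmem z).1 z.2 j⟩
      invFun := fun f => ⟨bE.equivFun.symm fun j => f j, (hmem _).2 fun j => by
        rw [← bE.equivFun_apply, LinearEquiv.apply_symm_apply]
        exact (f j).2⟩
      left_inv := fun z => Subtype.ext (bE.equivFun.symm_apply_apply (z : E))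
      right_inv := fun f => by
        ext j
        exact congrFun (bE.equivFun.apply_symm_apply fun j => (f j : F)) j
      map_add' := fun z w => by
        ext j
        exact congrFun (map_add bE.equivFun (z : E) w) j
      map_smul' := fun c z => by
        ext j
        exact congrFun (hsmul c z) j }
  have := finiteDimensional_riemannRochSpace hF A
  have h1 := e.finrank_eq
  rw [Module.finrank_pi_fintype, Finset.sum_const, Finset.card_univ, Fintype.card_fin, smul_eq_mul,
    ← Module.finrank_mul_finrank k k' (riemannRochSpace C)] at h1
  exact Nat.eq_of_mul_eq_mul_left Module.finrank_pos h1

/-- Conorms are cofinal among the divisors of `E`. -/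
theorem Divisor.exists_le_conorm (hF : IsFunctionField k F)
    (hE : IsConstantFieldExtension k k' F E) (D : Divisor k' E) :
    ∃ (A : Divisor k F) (C : Divisor k' E), (∀ Q, C Q = A (Q.restrict k F)) ∧ D ≤ C := by
  classical
  obtain ⟨C, hC⟩ := Divisor.exists_conorm hF hE
    (∑ Q ∈ D.support, Finsupp.single (Q.restrict k F) |D Q|)
  refine ⟨_, C, hC, fun Q => ?_⟩
  have hnonneg : ∀ Q' ∈ D.support,
      0 ≤ Finsupp.single (Q'.restrict k F) |D Q'| (Q.restrict k F) := fun Q' _ => by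
    rw [Finsupp.single_apply]
    split_ifs <;> simp
  rw [hC, Finsupp.finsetSum_apply]
  by_cases hQ : Q ∈ D.support
  · refine (le_abs_self _).trans ?_
    simpa using Finset.single_le_sum hnonneg hQ
  · rw [Finsupp.notMem_support_iff.1 hQ]
    exact Finset.sum_nonneg hnonneg

/-- The genus is invariant under constant field extensions. Conorms preserve degree and dimension
and are cofinal among the divisors of `E`. Boundedness of the two suprema is thus equivalent, so that
Riemann's theorem is not needed: if they are unbounded then both take the default value. -/
theorem genus_eq (hF : IsFunctionField k F) (hE : IsConstantFieldExtension k k' F E) :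
    genus k' E = genus k F := by
  have hFE := hE.isFunctionField hF
  have h1 : ∀ A : Divisor k F, ∃ C : Divisor k' E,
      C.degree - (Module.finrank k' (riemannRochSpace C) : ℤ) + 1 =
        A.degree - (Module.finrank k (riemannRochSpace A) : ℤ) + 1 := fun A => by
    obtain ⟨C, hC⟩ := Divisor.exists_conorm hF hE A
    exact ⟨C, by rw [Divisor.degree_eq_of_conorm hF hE hC,
      finrank_riemannRochSpace_conorm hF hE hC]⟩
  have h2 : ∀ D : Divisor k' E, ∃ A : Divisor k F,
      D.degree - (Module.finrank k' (riemannRochSpace D) : ℤ) + 1 ≤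
        A.degree - (Module.finrank k (riemannRochSpace A) : ℤ) + 1 := fun D => by
    obtain ⟨A, C, hC, hDC⟩ := Divisor.exists_le_conorm hF hE D
    refine ⟨A, ?_⟩
    rw [← Divisor.degree_eq_of_conorm hF hE hC, ← finrank_riemannRochSpace_conorm hF hE hC]
    exact add_le_add_left (degree_sub_finrank_le_of_le hFE hDC) 1
  unfold genus
  by_cases hb : BddAbove (Set.range fun A : Divisor k F =>
      A.degree - (Module.finrank k (riemannRochSpace A) : ℤ) + 1)
  · have hb' : BddAbove (Set.range fun D : Divisor k' E =>
        D.degree - (Module.finrank k' (riemannRochSpace D) : ℤ) + 1) := by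
      obtain ⟨M, hM⟩ := hb
      refine ⟨M, ?_⟩
      rintro _ ⟨D, rfl⟩
      obtain ⟨A, hA⟩ := h2 D
      exact hA.trans (hM ⟨A, rfl⟩)
    refine le_antisymm (ciSup_le fun D => ?_) (ciSup_le fun A => ?_)
    · obtain ⟨A, hA⟩ := h2 D
      exact hA.trans (le_ciSup hb A)
    · obtain ⟨C, hC⟩ := h1 A
      exact hC.ge.trans (le_ciSup hb' C)
  · have hb' : ¬ BddAbove (Set.range fun D : Divisor k' E =>
        D.degree - (Module.finrank k' (riemannRochSpace D) : ℤ) + 1) := by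
      rintro ⟨M, hM⟩
      refine hb ⟨M, ?_⟩
      rintro _ ⟨A, rfl⟩
      obtain ⟨C, hC⟩ := h1 A
      exact hC.ge.trans (hM ⟨C, rfl⟩)
    rw [iSup, iSup, csSup_of_not_bddAbove hb, csSup_of_not_bddAbove hb']

/-- Counting points with values in the extension of `k'` of degree `m` relates the numbers of places
of `E / k'` to those of `F / k`. -/
theorem sum_divisors_numPlaces (hF : IsFunctionField k F) (hE : IsConstantFieldExtension k k' F E)
    {m : ℕ} (hm : m ≠ 0) : ∑ d ∈ m.divisors, d * numPlaces k' E d =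
      ∑ d ∈ (Module.finrank k k' * m).divisors, d * numPlaces k F d := by
  have : Finite k' := Module.finite_of_finite k
  obtain ⟨L, _, _, hL⟩ := exists_finrank_eq k' hm
  let _ : Algebra k L := Algebra.compHom L (algebraMap k k')
  have : IsScalarTower k k' L := IsScalarTower.of_algebraMap_eq fun _ => rfl
  have : FiniteDimensional k' L :=
    Module.finite_of_finrank_pos (hL ▸ Nat.pos_of_ne_zero hm)
  have : FiniteDimensional k L := Module.Finite.trans k' L
  have : Finite L := Module.finite_of_finite k'
  rw [← hL, Module.finrank_mul_finrank, ← card_points hF L, ← card_points (hE.isFunctionField hF) L]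
  exact Nat.card_congr (Equiv.ofBijective _ (bijective_restrictPoint hF hE))

end Extension

/-! ### Limits -/

/-- Inversion of divisor sums in the limit: if `∑_{d ∣ m} d * u d` tends to `c` or to `0` according
to whether `s` divides `m`, then `u s` tends to `c / s`, and `u m` tends to `0` for `m ≠ s`. -/
theorem tendsto_of_tendsto_sum_divisors {α : Type*} {l : Filter α} {u : ℕ → α → ℝ} {s : ℕ} {c : ℝ}
    (h : ∀ m : ℕ, 1 ≤ m →
      Tendsto (fun n => ∑ d ∈ m.divisors, (d : ℝ) * u d n) l (𝓝 (if s ∣ m then c else 0)))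
    (m : ℕ) (hm : 1 ≤ m) : Tendsto (u m) l (𝓝 (if m = s then c / s else 0)) := by
  induction m using Nat.strong_induction_on with
  | _ m ih =>
    have hm0 : (m : ℝ) ≠ 0 := Nat.cast_ne_zero.2 (by omega)
    have h1 : Tendsto (fun n => ∑ d ∈ m.properDivisors, (d : ℝ) * u d n) l
        (𝓝 (∑ d ∈ m.properDivisors, (d : ℝ) * if d = s then c / s else 0)) := by
      refine tendsto_finsetSum _ fun d hd => (ih d (Nat.mem_properDivisors.1 hd).2 ?_).const_mul _
      exact Nat.pos_of_mem_properDivisors hd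
    have h2 := ((h m hm).sub h1).const_mul (m : ℝ)⁻¹
    have h3 : (fun n => (m : ℝ)⁻¹ * (∑ d ∈ m.divisors, (d : ℝ) * u d n -
        ∑ d ∈ m.properDivisors, (d : ℝ) * u d n)) = u m := by
      ext n
      rw [← Nat.cons_self_properDivisors (by omega), Finset.sum_cons, add_sub_cancel_right,
        inv_mul_cancel_left₀ hm0]
    have h4 : (m : ℝ)⁻¹ * ((if s ∣ m then c else 0) -
        ∑ d ∈ m.properDivisors, (d : ℝ) * if d = s then c / s else 0) =
          if m = s then c / s else 0 := by
      have h5 : ∑ d ∈ m.properDivisors, (d : ℝ) * (if d = s then c / s else 0) =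
          if s ∈ m.properDivisors then c else 0 := by
        simp_rw [mul_ite, mul_zero]
        rw [Finset.sum_ite_eq']
        split_ifs with hs
        · exact mul_div_cancel₀ _ (Nat.cast_ne_zero.2 (Nat.pos_of_mem_properDivisors hs).ne')
        · rfl
      rw [h5]
      by_cases hms : m = s
      · subst hms
        simp [div_eq_inv_mul]
      · have : s ∈ m.properDivisors ↔ s ∣ m := by
          rw [Nat.mem_properDivisors]
          exact ⟨fun h => h.1, fun h => ⟨h, (Nat.le_of_dvd (by omega) h).lt_of_ne (Ne.symm hms)⟩⟩
        simp [this, hms]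
    rwa [h3, h4] at h2

end AlgFunctionField

theorem proposition2
    {k : Type*} [Field k] [Finite k]
    (r i : ℕ) (hr : 1 ≤ r) (hi : 1 ≤ i) (hir : i ∣ r)
    {k' : Type*} [Field k'] [Algebra k k'] (hk' : Module.finrank k k' = i)
    (F : ℕ → Type*) [∀ n, Field (F n)] [∀ n, Algebra k (F n)]
    (E : ℕ → Type*) [∀ n, Field (E n)] [∀ n, Algebra k (E n)] [∀ n, Algebra k' (E n)]
    [∀ n, Algebra (F n) (E n)] [∀ n, IsScalarTower k k' (E n)]
    [∀ n, IsScalarTower k (F n) (E n)]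
    (hE : ∀ n, AlgFunctionField.IsConstantFieldExtension k k' (F n) (E n))
    (hF : AlgFunctionField.IsAsymptoticallyExactOfType k F
      (fun m => if m = r then (1 / (r : ℝ)) * ((Nat.card k : ℝ) ^ ((r : ℝ) / 2) - 1) else 0)) :
    AlgFunctionField.IsAsymptoticallyExactOfType k' E
      (fun m => if m = r / i then
        ((i : ℝ) / (r : ℝ)) * ((Nat.card k : ℝ) ^ ((r : ℝ) / 2) - 1) else 0) := by
  have hfin : FiniteDimensional k k' := Module.finite_of_finrank_pos (hk' ▸ hi)
  have hFn := hF.isAsymptoticallyExact.isFunctionField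
  have hint : ∀ n, Algebra.IsIntegral (F n) (E n) := fun n => by
    have : FiniteDimensional (F n) (E n) := Module.finite_of_finrank_pos (by
      rw [(hE n).finrank_eq (hFn n).algebraicClosure_eq_bot, hk']
      exact hi)
    infer_instance
  have hg : ∀ n, AlgFunctionField.genus k' (E n) = AlgFunctionField.genus k (F n) := fun n =>
    AlgFunctionField.genus_eq (hFn n) (hE n)
  obtain ⟨s, rfl⟩ := hir
  have hs : s ≠ 0 := by rintro rfl; omega
  have hi0 : (i : ℝ) ≠ 0 := Nat.cast_ne_zero.2 (by omega)
  have hs0 : (s : ℝ) ≠ 0 := Nat.cast_ne_zero.2 hs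
  set c : ℝ := (Nat.card k : ℝ) ^ (((i * s : ℕ) : ℝ) / 2) - 1 with hc
  have hlim : ∀ m, 1 ≤ m → Tendsto (fun n => (AlgFunctionField.numPlaces k' (E n) m : ℝ) /
      (AlgFunctionField.genus k' (E n) : ℝ)) atTop (𝓝 (if m = s then c / s else 0)) := by
    refine AlgFunctionField.tendsto_of_tendsto_sum_divisors
      (u := fun m n => (AlgFunctionField.numPlaces k' (E n) m : ℝ) /
        (AlgFunctionField.genus k' (E n) : ℝ)) fun m hm => ?_
    have h1 : ∀ n, ∑ d ∈ m.divisors, (d : ℝ) * ((AlgFunctionField.numPlaces k' (E n) d : ℝ) /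
        (AlgFunctionField.genus k' (E n) : ℝ)) = ∑ d ∈ (i * m).divisors, (d : ℝ) *
          ((AlgFunctionField.numPlaces k (F n) d : ℝ) /
            (AlgFunctionField.genus k (F n) : ℝ)) := fun n => by
      have h := AlgFunctionField.sum_divisors_numPlaces (hFn n) (hE n)
        (Nat.one_le_iff_ne_zero.1 hm)
      rw [hk'] at h
      simp_rw [hg n, ← mul_div_assoc, ← Finset.sum_div]
      congr 1
      exact_mod_cast h
    simp_rw [h1]
    have h2 : ∑ d ∈ (i * m).divisors, (d : ℝ) *
        (if d = i * s then 1 / ((i * s : ℕ) : ℝ) * c else 0) = if s ∣ m then c else 0 := by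
      simp_rw [mul_ite, mul_zero]
      rw [Finset.sum_ite_eq']
      have h3 : i * s ∈ (i * m).divisors ↔ s ∣ m := by
        rw [Nat.mem_divisors, Nat.mul_dvd_mul_iff_left hi]
        exact and_iff_left (Nat.mul_pos hi hm).ne'
      simp only [h3]
      split_ifs
      · push_cast
        field_simp
      · rfl
    rw [← h2]
    refine tendsto_finsetSum _ fun d hd => (hF.tendsto d ?_).const_mul _
    exact Nat.pos_of_mem_divisors hd
  refine ⟨⟨fun n => (hE n).isFunctionField (hFn n), ?_, ?_, fun m hm => ⟨_, hlim m hm⟩⟩,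
    fun m hm => ?_⟩
  · simp_rw [hg]
    exact hF.isAsymptoticallyExact.monotone_genus
  · simp_rw [hg]
    exact hF.isAsymptoticallyExact.tendsto_genus
  · have h5 : (i : ℝ) / ((i * s : ℕ) : ℝ) * c = c / s := by
      push_cast
      field_simp
    rw [Nat.mul_div_cancel_left s hi, h5]
    exact hlim m hm
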